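/- Let $n\ge 1$ and consider the root system of type $C_n$, $\Phi=\{\pm e_i\pm e_j : i\ne j\}\cup\{\pm 2e_i\}$ in the weight lattice $P=\mathbb{Z}^n$ with basis $e_1,\dots,e_n$, with positive roots $e_i\pm e_j$ $(i<j)$ and $2e_i$, Weyl group $W$ (signed permutations of coordinates), Weyl vector $\rho=\sum_j (n-j+1)e_j$, dominant weights $\mu_1\ge\dots\ge\mu_n\ge 0$, fundamental weights $\omega_r=e_1+\dots+e_r$ $(1\le r\le n)$ and $\omega_0=0$. For dominant $\mu$ let $\chi(\mu)=\sum_{w\in W}(-1)^{\ell(w)}e^{w(\mu+\rho)}\big/\sum_{w\in W}(-1)^{\ell(w)}e^{w\rho}$ be the irreducible (Weyl) character. Let $$\Delta(q,t)=\prod_{i\ge 0}\left[\left(\frac{1-q^{i+1}}{1-tq^{i}}\right)^{n}\prod_{\alpha\in\Phi}\frac{1-q^{i+1}e^{\alpha}}{1-tq^{i}e^{\alpha}}\right]\in\mathbb{C}[P][[q,t]]$$ be the Macdonald kernel. Then there is a unique family of formal power series $C_\mu(q,t)\in\mathbb{C}[[q,t]]$, indexed by the dominant weights $\mu$, such that $$\Delta(q,t)=\sum_{\mu\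 \mathrm{dominant}}C_\mu(q,t)\,\chi(\mu),$$ where for each monomial $q^at^b$ only finitely many $C_\mu$ have a nonzero coefficient at $q^at^b$ and the identity is read coefficientwise. Put $C_{k,n}(q,t)=C_{\omega_{2k}}(q,t)$ for $0\le 2k\le n$. Then the following identities hold in the field of fractions of $\mathbb{C}[[q,t]]$. (a) For every $k\ge 0$ with $2(k+1)\le n$, $$C_{k+1,n}(q,t)=\frac{(t^{2(n-2k-1)}-1)(t^{2(n-k+1)}-1)(1-qt^{2k-1})\,t^2}{(t^{2(n-2k+1)}-1)(t^{2(k+1)}-1)(1-qt^{2(n-k)-1})}\,C_{k,n}(q,t).$$ (b) For every $k\ge 0$ with $2k\le n$, $$C_{k,n}(q,t)=t^{2k}\,\frac{t^{2(n-2k+1)}-1}{t^{2(n-k+1)}-1}\ \prod_{i=1}^{k}\frac{t^{2(n-i+1)}-1}{t^{2i}-1}\ \prod_{i=0}^{k-1}\frac{1-qt^{2i-1}}{1-qt^{2(n-i)-1}}\ C_{0,n}(q,t).$$ -/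

import Mathlib

open Finset

noncomputable section

namespace MacdonaldC

/-- The weight lattice of type `C_n`, written in the coordinates `e_1, ..., e_n`
(indexed by `Fin n`, so that the coordinate along `e_{j+1}` is the value at `j`). -/
abbrev Weight (n : ℕ) : Type := Fin n → ℤ

/-- The group algebra `ℂ[P]` of the weight lattice. -/
abbrev GroupAlg (n : ℕ) : Type := AddMonoidAlgebra ℂ (Weight n)

/-- The formal exponential `e^μ`. -/
def fexp {n : ℕ} (μ : Weight n) : GroupAlg n := AddMonoidAlgebra.single μ 1

/-- The root system of type `C_n`: the vectors `± 2 e_i` and `± e_i ± e_j` with `i ≠ j`. -/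
def roots (n : ℕ) : Finset (Weight n) :=
  (univ : Finset (Fin n × ℤˣ)).image (fun p => Pi.single p.1 (2 * (p.2 : ℤ))) ∪
  ((univ : Finset ((Fin n × Fin n) × ℤˣ × ℤˣ)).filter (fun p => p.1.1 ≠ p.1.2)).image
    (fun p => Pi.single p.1.1 (p.2.1 : ℤ) + Pi.single p.1.2 (p.2.2 : ℤ))

/-- The Weyl vector `ρ = n e_1 + (n - 1) e_2 + ... + e_n`. -/
def rho (n : ℕ) : Weight n := fun j => (n : ℤ) - (j : ℕ)

/-- The elements of the Weyl group of type `C_n`: the signed permutations of the coordinates. -/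
abbrev Weyl (n : ℕ) : Type := Equiv.Perm (Fin n) × (Fin n → ℤˣ)

/-- The action of a signed permutation on weights. -/
def Weyl.act {n : ℕ} (w : Weyl n) (μ : Weight n) : Weight n :=
  fun j => (w.2 j : ℤ) * μ (w.1 j)

/-- The sign `(-1)^{l(w)}`, that is, the determinant of the action of `w`. -/
def Weyl.sgn {n : ℕ} (w : Weyl n) : ℤˣ := Equiv.Perm.sign w.1 * ∏ j, w.2 j

/-- The alternating sum `∑_w (-1)^{l(w)} e^{w μ}`. -/
def alternant {n : ℕ} (μ : Weight n) : GroupAlg n :=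
  ∑ w : Weyl n, ((w.sgn : ℤˣ) : ℤ) • fexp (w.act μ)

/-- Dominant weights: `μ_1 ≥ ... ≥ μ_n ≥ 0`. -/
def IsDominant {n : ℕ} (μ : Weight n) : Prop := Antitone μ ∧ ∀ j, 0 ≤ μ j

/-- The set of dominant weights. -/
abbrev DominantWeight (n : ℕ) : Type := {μ : Weight n // IsDominant μ}

/-- The irreducible character `χ(μ)`, given by Weyl's character formula
`χ(μ) = ∑_w (-1)^{l(w)} e^{w(μ + ρ)} / ∑_w (-1)^{l(w)} e^{w ρ}`. The quotient lies in the group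
algebra; it is formed in the field of fractions of that algebra. -/
def weylCharacter {n : ℕ} (μ : DominantWeight n) : FractionRing (GroupAlg n) :=
  algebraMap (GroupAlg n) (FractionRing (GroupAlg n)) (alternant (μ.1 + rho n)) /
    algebraMap (GroupAlg n) (FractionRing (GroupAlg n)) (alternant (rho n))

/-- Formal power series in the two variables `q` and `t`. -/
abbrev QT (R : Type) : Type := MvPowerSeries (Fin 2) R

/-- The variable `q`. -/
def qVar (R : Type) [CommRing R] : QT R := MvPowerSeries.X 0

/-- The variable `t`. -/
def tVar (R : Type) [CommRing R] : QT R := MvPowerSeries.X 1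

/-- The series `(1 - q^{i+1} e^γ) / (1 - t q^i e^γ)`. -/
def kernelTerm {n : ℕ} (i : ℕ) (γ : Weight n) : QT (GroupAlg n) :=
  (1 - qVar _ ^ (i + 1) * MvPowerSeries.C (fexp γ)) *
    MvPowerSeries.invOfUnit (1 - tVar _ * qVar _ ^ i * MvPowerSeries.C (fexp γ)) 1

/-- The `i`-th factor of the Macdonald kernel: the product of
`(1 - q^{i+1} e^γ) / (1 - t q^i e^γ)` over the weights `γ` of the adjoint representation with
multiplicity (the roots, and `n` times the weight `0`). -/
def kernelFactor (n i : ℕ) : QT (GroupAlg n) :=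
  kernelTerm i (0 : Weight n) ^ n * ∏ α ∈ roots n, kernelTerm i α

/-- The Macdonald kernel
`Δ(q,t) = ∏_{i ≥ 0} ∏_γ (1 - q^{i+1} e^γ) / (1 - t q^i e^γ)` of type `C_n`.
As the `i`-th factor is `1` modulo `q^i`, the coefficient of `q^a t^b` in the infinite product is
the one in the product of the factors with `i ≤ a`; see `coeff_prod_kernelFactor`. -/
def macdonaldKernel (n : ℕ) : QT (GroupAlg n) :=
  fun m => MvPowerSeries.coeff m (∏ i ∈ range (m 0 + 1), kernelFactor n i)

theorem kernelTerm_mul {n : ℕ} (i : ℕ) (γ : Weight n) :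
    kernelTerm i γ * (1 - tVar _ * qVar _ ^ i * MvPowerSeries.C (fexp γ)) =
      1 - qVar _ ^ (i + 1) * MvPowerSeries.C (fexp γ) := by
  unfold kernelTerm
  rw [mul_assoc, MvPowerSeries.invOfUnit_mul, mul_one]
  simp [tVar]

theorem kernelTerm_sub_one {n : ℕ} (i : ℕ) (γ : Weight n) :
    (qVar (GroupAlg n)) ^ i ∣ kernelTerm i γ - 1 := by
  have h := kernelTerm_mul i γ
  refine ⟨kernelTerm i γ * tVar _ * MvPowerSeries.C (fexp γ)
    - qVar _ * MvPowerSeries.C (fexp γ), ?_⟩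
  linear_combination h

theorem kernelFactor_sub_one (n i : ℕ) :
    (qVar (GroupAlg n)) ^ i ∣ kernelFactor n i - 1 := by
  have key : ∀ γ : Weight n, Ideal.Quotient.mk (Ideal.span {(qVar (GroupAlg n)) ^ i})
      (kernelTerm i γ) = 1 := by
    intro γ
    rw [← map_one (Ideal.Quotient.mk _), Ideal.Quotient.eq, Ideal.mem_span_singleton]
    exact kernelTerm_sub_one i γ
  rw [← Ideal.mem_span_singleton, ← Ideal.Quotient.eq, kernelFactor]
  simp [key]

/-- The partial products of the Macdonald kernel stabilize coefficientwise. -/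
theorem coeff_prod_kernelFactor (n : ℕ) (m : Fin 2 →₀ ℕ) (N : ℕ) (hN : m 0 + 1 ≤ N) :
    MvPowerSeries.coeff m (∏ i ∈ range N, kernelFactor n i) =
      MvPowerSeries.coeff m (macdonaldKernel n) := by
  have hdef : MvPowerSeries.coeff m (macdonaldKernel n) =
      MvPowerSeries.coeff m (∏ i ∈ range (m 0 + 1), kernelFactor n i) := rfl
  rw [hdef]
  induction N, hN using Nat.le_induction with
  | base => rfl
  | succ N hN ih =>
    rw [← ih, prod_range_succ, ← sub_eq_zero, ← map_sub]
    have hd : (MvPowerSeries.X 0 : QT (GroupAlg n)) ^ N ∣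
        (∏ i ∈ range N, kernelFactor n i) * kernelFactor n N -
          ∏ i ∈ range N, kernelFactor n i := by
      have h := (kernelFactor_sub_one n N).mul_left (∏ i ∈ range N, kernelFactor n i)
      rwa [mul_sub, mul_one] at h
    exact MvPowerSeries.X_pow_dvd_iff.1 hd m (by omega)

/-- The relation `Δ(q,t) = ∑_μ C_μ(q,t) χ(μ)`, the sum being over the dominant weights, for a
family of power series `C_μ(q,t)`. It is read coefficientwise in `q` and `t`, each coefficient
being a finite linear combination of characters. -/
structure IsKernelExpansion (n : ℕ) (C : DominantWeight n → QT ℂ) : Prop where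
  finite : ∀ m : Fin 2 →₀ ℕ, {μ | MvPowerSeries.coeff m (C μ) ≠ 0}.Finite
  expansion : ∀ m : Fin 2 →₀ ℕ,
    algebraMap (GroupAlg n) (FractionRing (GroupAlg n))
        (MvPowerSeries.coeff m (macdonaldKernel n)) =
      ∑ᶠ μ : DominantWeight n, MvPowerSeries.coeff m (C μ) • weylCharacter μ

/-- The fundamental weight `ω_r = e_1 + ... + e_r` for `r ≤ n`, with `ω_0 = 0`. -/
def fundamentalWeight (n r : ℕ) : DominantWeight n :=
  ⟨fun j => if (j : ℕ) < r then 1 else 0, by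
    constructor
    · intro i j hij
      have : (i : ℕ) ≤ j := hij
      dsimp only
      split_ifs <;> omega
    · intro j
      dsimp only
      split_ifs <;> simp⟩

/-- The field of fractions of `ℂ[[q,t]]`. -/
abbrev QTField : Type := FractionRing (QT ℂ)

/-- A power series as an element of the field of fractions. -/
def toField (f : QT ℂ) : QTField := algebraMap (QT ℂ) QTField f

/-- `q` in the field of fractions. -/
def qq : QTField := toField (qVar ℂ)

/-- `t` in the field of fractions. -/
def tt : QTField := toField (tVar ℂ)

/-- For a family `C_μ`, the coefficient `C_{k,n} = C_{ω_{2k}}` in the field of fractions. -/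
def coeffC (n : ℕ) (C : DominantWeight n → QT ℂ) (k : ℕ) : QTField :=
  toField (C (fundamentalWeight n (2 * k)))

end MacdonaldC

end

noncomputable section

namespace MacdonaldC

/-! The coefficient `C_μ` is forced: it is the coefficient of `e^{μ+ρ}` in `Δ · ∑_w (-1)^{l(w)}
e^{wρ}`, taken separately for each monomial in `q` and `t`. Existence comes from the Weyl invariance
of `Δ` (`isSymm_coeff_macdonaldKernel`, `isKernelExpansion_multiplicitySeries`). Formula (b)
telescopes from (a), so the content is (a).

With denominators cleared, (a) is an identity of power series, and such an identity may be tested at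
`t = q^{s+1}` for all `s` (`eq_zero_of_specialize_eq_zero`). There `Δ` collapses to a finite product
and both sides become polynomials in `q`, so it suffices to treat complex `q ≠ 0, 1`.

For such `q` put `t = q^s` and `w_s = ∏_α ∏_{m<s} (1 - q^m e^α)`. Up to sign and a scalar power of
`∏ (1 - q^m)`, this is `Δ` times the square of the Weyl denominator (`prod_mul_weightPoly`), so
multiplicities in `Δ` become constant terms against `w_s`. Let `H(X) = ∏_j (1 - x_j X)(1 - x_j⁻¹
X)`, with coefficients `H_r`. Since `H_{r+2} - H_r = (-1)^r χ(ω_{r+2})`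
(`coeff_extPoly_sub_mul_alternant`), everything follows from a two-term recurrence for the constant
terms `g_r` of `w_s H_r` (`constTerm_recurrence`): the differences `g_{r+2} - g_r` then factor, and
the ratio of consecutive ones is (a).

The recurrence comes from the `q`-shifts `T_i : x_i ↦ q x_i`, which preserve constant terms.
Suitable multiples `B_i`, `B_i'` of `w_s` satisfy `CT(B_i (T_i f - f) + B_i' (T_i⁻¹ f - f)) = 0` for
all `f` (`constTerm_qShift_sub`). Applied to the coefficients of `H(X)` and summed over `i`, the
left side is evaluated by polynomial interpolation in `X` (`interpPoly_eq_zero`): it is `w_s` times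
an explicit combination of `H(tX)`, `H(t⁻¹X)` and `H(X)`. Comparing coefficients of `X^{r+2}` gives
the recurrence. -/

variable {n : ℕ}

/-! ### The Weyl group acting on weights and on the group algebra -/

theorem fexp_zero : fexp (0 : Weight n) = 1 := rfl

theorem fexp_add (μ ν : Weight n) : fexp (μ + ν) = fexp μ * fexp ν := by
  simp [fexp, AddMonoidAlgebra.single_mul_single]

theorem fexp_injective : Function.Injective (fexp : Weight n → GroupAlg n) :=
  AddMonoidAlgebra.single_left_injective one_ne_zero

theorem coeff_fexp (μ ν : Weight n) : (fexp μ).coeff ν = if μ = ν then 1 else 0 := by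
  classical
  simp [fexp, AddMonoidAlgebra.coeff_single, Finsupp.single_apply]

theorem coeff_zsmul (k : ℤ) (f : GroupAlg n) (μ : Weight n) :
    (k • f).coeff μ = k * f.coeff μ := by
  rw [AddMonoidAlgebra.coeff_smul, Finsupp.smul_apply, zsmul_eq_mul]

/-- The action of a signed permutation as an additive map. -/
def Weyl.actHom (w : Weyl n) : Weight n →+ Weight n where
  toFun := w.act
  map_zero' := by ext j; simp [Weyl.act]
  map_add' μ ν := by ext j; simp [Weyl.act, mul_add]

/-- The action of a signed permutation on the group algebra. -/
def Weyl.actAlg (w : Weyl n) : GroupAlg n →ₐ[ℂ] GroupAlg n :=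
  AddMonoidAlgebra.mapDomainAlgHom ℂ ℂ w.actHom

theorem Weyl.actAlg_fexp (w : Weyl n) (μ : Weight n) : w.actAlg (fexp μ) = fexp (w.act μ) := by
  simp [Weyl.actAlg, fexp, Weyl.actHom]

theorem Weyl.act_add (w : Weyl n) (μ ν : Weight n) : w.act (μ + ν) = w.act μ + w.act ν :=
  map_add w.actHom μ ν

/-- The product `v * w` in the order for which `w.act (v.act μ) = (v.comp w).act μ`. -/
def Weyl.comp (v w : Weyl n) : Weyl n := (v.1 * w.1, fun j => w.2 j * v.2 (w.1 j))

theorem Weyl.act_comp (v w : Weyl n) (μ : Weight n) : (v.comp w).act μ = w.act (v.act μ) := by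
  ext j
  simp [Weyl.act, Weyl.comp, mul_assoc]

theorem Weyl.sgn_comp (v w : Weyl n) : (v.comp w).sgn = w.sgn * v.sgn := by
  simp only [Weyl.sgn, Weyl.comp, prod_mul_distrib, Equiv.Perm.sign_mul,
    Equiv.prod_comp w.1 (fun j => v.2 j)]
  ac_rfl

theorem Weyl.comp_left_injective (w : Weyl n) : Function.Injective (fun v : Weyl n => v.comp w) := by
  rintro ⟨a, b⟩ ⟨a', b'⟩ h
  simp only [Weyl.comp, Prod.mk.injEq, mul_left_inj] at h
  obtain ⟨rfl, h⟩ := h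
  congr 1
  ext j
  have := congrFun h (w.1.symm j)
  simpa [Units.ext_iff] using this

theorem Weyl.act_injective (w : Weyl n) : Function.Injective w.act := by
  intro μ ν h
  ext j
  have := congrFun h (w.1.symm j)
  simpa [Weyl.act] using this

theorem Weyl.coeff_actAlg (w : Weyl n) (f : GroupAlg n) (μ : Weight n) :
    (w.actAlg f).coeff (w.act μ) = f.coeff μ := by
  change (Finsupp.mapDomain w.act f.coeff) (w.act μ) = _
  exact Finsupp.mapDomain_apply w.act_injective _ _

/-- Elements of the group algebra that transform under the Weyl group by the sign. -/
def IsAntisymm (f : GroupAlg n) : Prop := ∀ w : Weyl n, w.actAlg f = (w.sgn : ℤ) • f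

/-- Elements of the group algebra fixed by the Weyl group. -/
def IsSymm (f : GroupAlg n) : Prop := ∀ w : Weyl n, w.actAlg f = f

theorem Weyl.sgn_mul_self (w : Weyl n) : ((w.sgn : ℤˣ) : ℤ) * (w.sgn : ℤ) = 1 := by
  rw [← Units.val_mul, Int.units_mul_self, Units.val_one]

theorem IsAntisymm.coeff_act {f : GroupAlg n} (hf : IsAntisymm f) (w : Weyl n) (μ : Weight n) :
    f.coeff (w.act μ) = (w.sgn : ℤ) * f.coeff μ := by
  have h := w.coeff_actAlg f μ
  rw [hf w] at h
  have hs := w.sgn_mul_self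
  have hs' : (((w.sgn : ℤˣ) : ℤ) : ℂ) * ((w.sgn : ℤ) : ℂ) = 1 := by exact_mod_cast hs
  have h2 : (((w.sgn : ℤˣ) : ℤ) : ℂ) * f.coeff (w.act μ) = f.coeff μ := by
    rw [← h, coeff_zsmul]
  rw [← h2, ← mul_assoc, hs', one_mul]

theorem alternant_isAntisymm (μ : Weight n) : IsAntisymm (alternant μ) := by
  intro w
  rw [alternant, map_sum, smul_sum]
  refine Fintype.sum_bijective (fun v : Weyl n => v.comp w)
    (Finite.injective_iff_bijective.1 w.comp_left_injective) _ _ fun v => ?_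
  rw [map_zsmul, Weyl.actAlg_fexp, Weyl.act_comp, Weyl.sgn_comp, smul_smul]
  congr 1
  rw [Units.val_mul, ← mul_assoc, Weyl.sgn_mul_self, one_mul]

theorem IsSymm.mul_isAntisymm {f g : GroupAlg n} (hf : IsSymm f) (hg : IsAntisymm g) :
    IsAntisymm (f * g) := by
  intro w
  rw [map_mul, hf w, hg w, mul_smul_comm]

theorem IsAntisymm.sub {f g : GroupAlg n} (hf : IsAntisymm f) (hg : IsAntisymm g) :
    IsAntisymm (f - g) := by
  intro w
  rw [map_sub, hf w, hg w, smul_sub]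

theorem IsAntisymm.sum {ι : Type*} {s : Finset ι} {f : ι → GroupAlg n}
    (hf : ∀ i ∈ s, IsAntisymm (f i)) : IsAntisymm (∑ i ∈ s, f i) := by
  intro w
  rw [map_sum, smul_sum]
  exact sum_congr rfl fun i hi => hf i hi w

theorem IsAntisymm.smul {f : GroupAlg n} (hf : IsAntisymm f) (c : ℂ) : IsAntisymm (c • f) := by
  intro w
  rw [map_smul, hf w, smul_comm]

/-! ### Dominant weights -/

theorem IsDominant.strictAnti_add_rho {μ : Weight n} (hμ : IsDominant μ) :
    StrictAnti (μ + rho n) := by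
  intro i j hij
  have h1 := hμ.1 hij.le
  have h2 : (i : ℕ) < j := hij
  simp only [Pi.add_apply, rho]
  omega

theorem IsDominant.add_rho_pos {μ : Weight n} (hμ : IsDominant μ) (j : Fin n) :
    0 < (μ + rho n) j := by
  have h1 := hμ.2 j
  have := j.2
  simp only [Pi.add_apply, rho]
  omega

/-- Integrality turns strict decrease into `κ_i ≥ κ_j + (j - i)`, and positivity of the last
coordinate then gives `κ_j ≥ n - j = ρ_j`. -/
theorem isDominant_sub_rho {κ : Weight n} (h1 : StrictAnti κ) (h2 : ∀ j, 0 < κ j) :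
    IsDominant (κ - rho n) := by
  have key : ∀ d : ℕ, ∀ i j : Fin n, (j : ℕ) = i + d → κ j + d ≤ κ i := by
    intro d
    induction d with
    | zero =>
      intro i j h
      have : i = j := Fin.ext (by omega)
      subst this
      simp
    | succ d ih =>
      intro i j h
      have hj := j.2
      have := ih i ⟨i + d, by omega⟩ rfl
      have h3 : κ j < κ ⟨i + d, by omega⟩ := h1 (by simp [Fin.lt_def]; omega)
      push_cast
      omega
  constructor
  · intro i j hij
    have hij' : (i : ℕ) ≤ j := hij
    have := key (j - i) i j (by omega)
    simp only [Pi.sub_apply, rho]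
    omega
  · intro j
    have hj := j.2
    have := key (n - 1 - j) j ⟨n - 1, by omega⟩ (by simp; omega)
    have := h2 ⟨n - 1, by omega⟩
    simp only [Pi.sub_apply, rho]
    omega

theorem perm_eq_one_of_strictAnti {κ ν : Weight n} (hκ : StrictAnti κ) (hν : StrictAnti ν)
    {σ : Equiv.Perm (Fin n)} (h : ∀ j, ν j = κ (σ j)) : σ = 1 := by
  have hσ : StrictMono σ := by
    intro i j hij
    have := hν hij
    rw [h, h] at this
    exact hκ.lt_iff_gt.1 this
  have : (hσ.orderIsoOfSurjective σ σ.surjective) = OrderIso.refl _ := Subsingleton.elim _ _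
  ext j
  have h2 := congrArg (fun e : Fin n ≃o Fin n => (e j : ℕ)) this
  simpa using h2

theorem Weyl.eq_of_act_eq {κ ν : Weight n} (hκ : StrictAnti κ) (hν : StrictAnti ν)
    (hκ0 : ∀ j, 0 < κ j) (hν0 : ∀ j, 0 < ν j) {w : Weyl n} (h : w.act κ = ν) :
    w = (1, 1) := by
  have hs : ∀ j, w.2 j = 1 := by
    intro j
    have h1 := congrFun h j
    have h2 := hν0 j
    have h3 := hκ0 (w.1 j)
    rcases Int.units_eq_one_or (w.2 j) with h4 | h4
    · exact h4
    · simp only [Weyl.act, h4] at h1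
      norm_num at h1
      omega
  have hp : w.1 = 1 := perm_eq_one_of_strictAnti hκ hν fun j => by
    rw [← h]; simp [Weyl.act, hs]
  exact Prod.ext hp (funext hs)

theorem coeff_alternant (μ ν : Weight n) :
    (alternant μ).coeff ν = ∑ w : Weyl n, if w.act μ = ν then ((w.sgn : ℤ) : ℂ) else 0 := by
  rw [alternant, AddMonoidAlgebra.coeff_sum, Finsupp.finsetSum_apply]
  simp only [coeff_zsmul, coeff_fexp, mul_ite, mul_one, mul_zero]

theorem coeff_alternant_add_rho (μ ν : DominantWeight n) :
    (alternant (μ.1 + rho n)).coeff (ν.1 + rho n) = if μ = ν then 1 else 0 := by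
  rw [coeff_alternant]
  have key : ∀ w : Weyl n, w.act (μ.1 + rho n) = ν.1 + rho n ↔ (w = (1, 1) ∧ μ = ν) := by
    intro w
    constructor
    · intro h
      have h1 := Weyl.eq_of_act_eq μ.2.strictAnti_add_rho ν.2.strictAnti_add_rho
        μ.2.add_rho_pos ν.2.add_rho_pos h
      refine ⟨h1, ?_⟩
      subst h1
      have h2 : μ.1 + rho n = ν.1 + rho n := by
        rw [← h]; ext j; simp [Weyl.act]
      exact Subtype.ext (add_right_cancel h2)
    · rintro ⟨rfl, rfl⟩
      ext j; simp [Weyl.act]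
  simp only [key]
  by_cases h : μ = ν
  · simp [h, Weyl.sgn]
  · simp [h]

theorem exists_act_antitone (μ : Weight n) :
    ∃ w : Weyl n, Antitone (w.act μ) ∧ ∀ j, 0 ≤ w.act μ j := by
  let f : Fin n → ℤ := fun j => -|μ j|
  let σ := Tuple.sort f
  have hσ : Monotone (f ∘ σ) := Tuple.monotone_sort f
  let w : Weyl n := (σ, fun j => if 0 ≤ μ (σ j) then 1 else -1)
  have hw : ∀ j, w.act μ j = |μ (σ j)| := by
    intro j
    simp only [Weyl.act, w]
    split_ifs with h
    · simp [abs_of_nonneg h]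
    · simp [abs_of_neg (not_le.1 h)]
  refine ⟨w, ?_, fun j => by rw [hw]; exact abs_nonneg _⟩
  intro i j hij
  have := hσ hij
  simp only [Function.comp, f] at this
  rw [hw, hw]
  omega

theorem IsAntisymm.coeff_eq_zero_of_act_eq {f : GroupAlg n} (hf : IsAntisymm f) {w : Weyl n}
    {μ : Weight n} (h : w.act μ = μ) (hw : w.sgn = -1) : f.coeff μ = 0 := by
  have h1 := hf.coeff_act w μ
  rw [h, hw] at h1
  norm_num at h1
  linear_combination h1 / 2

theorem IsAntisymm.coeff_eq_zero_of_apply_eq_zero {f : GroupAlg n} (hf : IsAntisymm f)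
    {μ : Weight n} {i : Fin n} (h : μ i = 0) : f.coeff μ = 0 := by
  refine hf.coeff_eq_zero_of_act_eq (w := (1, Function.update 1 i (-1))) ?_ ?_
  · ext j
    by_cases hj : j = i
    · subst hj; simp [Weyl.act, h]
    · simp [Weyl.act, hj]
  · simp [Weyl.sgn, prod_update_of_mem]

theorem IsAntisymm.coeff_eq_zero_of_apply_eq {f : GroupAlg n} (hf : IsAntisymm f)
    {μ : Weight n} {i j : Fin n} (hij : i ≠ j) (h : μ i = μ j) : f.coeff μ = 0 := by
  refine hf.coeff_eq_zero_of_act_eq (w := (Equiv.swap i j, 1)) ?_ ?_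
  · ext k
    simp only [Weyl.act, Pi.one_apply, Units.val_one, one_mul]
    rw [Equiv.swap_apply_def]
    split_ifs with h1 h2
    · rw [h1, h]
    · rw [h2, h]
    · rfl
  · simp [Weyl.sgn, Equiv.Perm.sign_swap hij]

/-- Every orbit meets the closed dominant chamber. A weight there either lies on a wall, where a
reflection of sign `-1` fixes it and kills the coefficient, or is strictly dominant and hence of the
form `μ + ρ`. -/
theorem IsAntisymm.eq_zero {f : GroupAlg n} (hf : IsAntisymm f)
    (h : ∀ μ : DominantWeight n, f.coeff (μ.1 + rho n) = 0) : f = 0 := by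
  ext κ
  obtain ⟨w, h1, h2⟩ := exists_act_antitone κ
  have h3 := hf.coeff_act w κ
  have h4 : f.coeff (w.act κ) = 0 := by
    by_cases hinj : Function.Injective (w.act κ)
    · by_cases hpos : ∀ j, 0 < w.act κ j
      · have := h ⟨w.act κ - rho n, isDominant_sub_rho (h1.strictAnti_of_injective hinj) hpos⟩
        simpa using this
      · push Not at hpos
        obtain ⟨j, hj⟩ := hpos
        exact hf.coeff_eq_zero_of_apply_eq_zero (le_antisymm hj (h2 j))
    · simp only [Function.Injective] at hinj
      push Not at hinj
      obtain ⟨i, j, hij, hne⟩ := hinj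
      exact hf.coeff_eq_zero_of_apply_eq hne hij
  rw [h4] at h3
  have h5 : ((w.sgn : ℤ) : ℂ) ≠ 0 := by
    intro h
    have := w.sgn_mul_self
    rw [Int.cast_eq_zero] at h
    rw [h] at this
    norm_num at this
  simpa [h5] using h3.symm

/-! ### Multiplicities and the expansion of invariants in Weyl characters. -/

/-- The coefficient of `e^{μ+ρ}` in `f · ∑_w (-1)^{l(w)} e^{wρ}`: for a Weyl invariant `f`, the
multiplicity of the irreducible character of highest weight `μ`. -/
def multiplicity (μ : Weight n) : GroupAlg n →ₗ[ℂ] ℂ where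
  toFun f := (f * alternant (rho n)).coeff (μ + rho n)
  map_add' f g := by simp [add_mul]
  map_smul' c f := by simp

theorem finite_multiplicity_ne_zero (f : GroupAlg n) :
    {μ : DominantWeight n | multiplicity μ.1 f ≠ 0}.Finite := by
  have h := (f * alternant (rho n)).coeff.hasFiniteSupport
  refine Set.Finite.of_injOn (f := fun μ : DominantWeight n => μ.1 + rho n) ?_ ?_ h
  · intro μ hμ
    exact hμ
  · intro μ _ ν _ h
    exact Subtype.ext (add_right_cancel h)

theorem alternant_rho_ne_zero : alternant (rho n) ≠ 0 := by
  intro h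
  have h0 : IsDominant (0 : Weight n) := ⟨fun _ _ _ => le_rfl, fun _ => le_rfl⟩
  have := coeff_alternant_add_rho (⟨0, h0⟩ : DominantWeight n) ⟨0, h0⟩
  simp [h] at this

/-- Both sides are antisymmetric, so only the coefficients at `ν + ρ` with `ν` dominant need
comparing; there the alternants form a dual basis. -/
theorem IsSymm.mul_alternant_eq_sum {f : GroupAlg n} (hf : IsSymm f) (s : Finset (DominantWeight n))
    (hs : ∀ μ : DominantWeight n, multiplicity μ.1 f ≠ 0 → μ ∈ s) :
    f * alternant (rho n) = ∑ μ ∈ s, multiplicity μ.1 f • alternant (μ.1 + rho n) := by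
  rw [← sub_eq_zero]
  refine IsAntisymm.eq_zero ((hf.mul_isAntisymm (alternant_isAntisymm _)).sub
    (IsAntisymm.sum fun μ _ => (alternant_isAntisymm _).smul _)) fun ν => ?_
  have h1 : (f * alternant (rho n)).coeff (ν.1 + rho n) = multiplicity ν.1 f := rfl
  rw [AddMonoidAlgebra.coeff_sub, AddMonoidAlgebra.coeff_sum, Finsupp.sub_apply,
    Finsupp.finsetSum_apply, h1]
  simp only [AddMonoidAlgebra.coeff_smul, Finsupp.smul_apply, coeff_alternant_add_rho]
  by_cases hν : ν ∈ s
  · simp [hν]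
  · have : multiplicity ν.1 f = 0 := by
      by_contra h
      exact hν (hs ν h)
    simp [this, hν]

theorem algebraMap_alternant_rho_ne_zero :
    algebraMap (GroupAlg n) (FractionRing (GroupAlg n)) (alternant (rho n)) ≠ 0 := by
  rw [Ne, FaithfulSMul.algebraMap_eq_zero_iff]
  exact alternant_rho_ne_zero

theorem algebraMap_eq_sum_smul_weylCharacter_iff (f : GroupAlg n) (s : Finset (DominantWeight n))
    (c : DominantWeight n → ℂ) :
    algebraMap (GroupAlg n) (FractionRing (GroupAlg n)) f = ∑ μ ∈ s, c μ • weylCharacter μ ↔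
      f * alternant (rho n) = ∑ μ ∈ s, c μ • alternant (μ.1 + rho n) := by
  have h0 := algebraMap_alternant_rho_ne_zero (n := n)
  rw [← (FaithfulSMul.algebraMap_injective (GroupAlg n) (FractionRing (GroupAlg n))).eq_iff,
    map_mul, map_sum, ← eq_div_iff h0, sum_div]
  have : ∀ μ : DominantWeight n, algebraMap (GroupAlg n) (FractionRing (GroupAlg n))
      (c μ • alternant (μ.1 + rho n)) / algebraMap (GroupAlg n) _ (alternant (rho n)) =
      c μ • weylCharacter μ := by
    intro μ
    rw [weylCharacter, Algebra.algebraMap_eq_smul_one (c μ • _), smul_assoc,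
      ← Algebra.algebraMap_eq_smul_one, smul_div_assoc]
  simp only [this]

/-- The coefficients in a kernel expansion are the coefficientwise multiplicities. -/
theorem IsKernelExpansion.coeff_eq {C : DominantWeight n → QT ℂ} (hC : IsKernelExpansion n C)
    (m : Fin 2 →₀ ℕ) (ν : DominantWeight n) :
    MvPowerSeries.coeff m (C ν) =
      multiplicity ν.1 (MvPowerSeries.coeff m (macdonaldKernel n)) := by
  have h := hC.expansion m
  rw [finsum_eq_sum_of_support_subset (s := (hC.finite m).toFinset) _ (by
    intro μ hμ
    simp only [Function.mem_support] at hμ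
    simp only [Set.Finite.coe_toFinset, Set.mem_ofPred_eq]
    intro h
    exact hμ (by rw [h, zero_smul])), algebraMap_eq_sum_smul_weylCharacter_iff] at h
  have h1 : multiplicity ν.1 (MvPowerSeries.coeff m (macdonaldKernel n)) =
    (MvPowerSeries.coeff m (macdonaldKernel n) * alternant (rho n)).coeff (ν.1 + rho n) := rfl
  rw [h1, h, AddMonoidAlgebra.coeff_sum, Finsupp.finsetSum_apply]
  simp only [AddMonoidAlgebra.coeff_smul, Finsupp.smul_apply, coeff_alternant_add_rho]
  simp only [smul_eq_mul, mul_ite, mul_one, mul_zero, sum_ite_eq', Set.Finite.mem_toFinset,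
    Set.mem_ofPred_eq]
  split_ifs with h2
  · rfl
  · exact not_not.1 h2

/-- Coefficientwise multiplicities of a series over the group algebra. -/
def multiplicitySeries (μ : Weight n) (f : QT (GroupAlg n)) : QT ℂ :=
  fun m => multiplicity μ (MvPowerSeries.coeff m f)

theorem isKernelExpansion_multiplicitySeries
    (h : ∀ m, IsSymm (MvPowerSeries.coeff m (macdonaldKernel n))) :
    IsKernelExpansion n fun μ => multiplicitySeries μ.1 (macdonaldKernel n) := by
  have hfin := fun m => finite_multiplicity_ne_zero (MvPowerSeries.coeff m (macdonaldKernel n))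
  refine ⟨hfin, fun m => ?_⟩
  rw [finsum_eq_sum_of_support_subset (s := (hfin m).toFinset) _ (by
    intro μ hμ
    simp only [Function.mem_support] at hμ
    simp only [Set.Finite.coe_toFinset, Set.mem_ofPred_eq]
    intro h
    exact hμ (smul_eq_zero_of_left h _)), algebraMap_eq_sum_smul_weylCharacter_iff]
  exact (h m).mul_alternant_eq_sum _ fun μ hμ => by simpa using hμ

theorem IsKernelExpansion.eq_multiplicitySeries {C : DominantWeight n → QT ℂ}
    (hC : IsKernelExpansion n C) :
    C = fun μ => multiplicitySeries μ.1 (macdonaldKernel n) := by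
  funext μ
  ext m
  exact hC.coeff_eq m μ

/-! ### Products over the roots -/

theorem mem_roots {α : Weight n} : α ∈ roots n ↔
    (∃ (i : Fin n) (a : ℤˣ), Pi.single i (2 * (a : ℤ)) = α) ∨
    ∃ (i j : Fin n) (a b : ℤˣ), i ≠ j ∧ Pi.single i (a : ℤ) + Pi.single j (b : ℤ) = α := by
  simp only [roots, mem_union, mem_image, mem_univ, true_and, mem_filter, Prod.exists]

theorem Weyl.act_single (w : Weyl n) (i : Fin n) (c : ℤ) :
    w.act (Pi.single i c) = Pi.single (w.1.symm i) ((w.2 (w.1.symm i) : ℤ) * c) := by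
  ext j
  by_cases h : j = w.1.symm i
  · subst h; simp [Weyl.act]
  · have h2 : w.1 j ≠ i := fun h' => h (by rw [← h', Equiv.symm_apply_apply])
    simp [Weyl.act, h, h2]

theorem Weyl.act_mem_roots (w : Weyl n) {α : Weight n} (hα : α ∈ roots n) :
    w.act α ∈ roots n := by
  rw [mem_roots] at hα ⊢
  rcases hα with ⟨i, a, rfl⟩ | ⟨i, j, a, b, hij, rfl⟩
  · left
    refine ⟨w.1.symm i, w.2 (w.1.symm i) * a, ?_⟩
    rw [Weyl.act_single, Units.val_mul]
    ring_nf
  · right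
    refine ⟨w.1.symm i, w.1.symm j, w.2 (w.1.symm i) * a, w.2 (w.1.symm j) * b, ?_, ?_⟩
    · simpa using hij
    · rw [Weyl.act_add, Weyl.act_single, Weyl.act_single, Units.val_mul, Units.val_mul]

theorem Weyl.prod_roots_act {M : Type*} [CommMonoid M] (w : Weyl n) (g : Weight n → M) :
    ∏ α ∈ roots n, g (w.act α) = ∏ α ∈ roots n, g α := by
  classical
  have h1 : (roots n).image w.act = roots n := by
    refine eq_of_subset_of_card_le ?_ ?_
    · intro α hα
      obtain ⟨β, hβ, rfl⟩ := mem_image.1 hα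
      exact w.act_mem_roots hβ
    · rw [card_image_of_injective _ w.act_injective]
  conv_rhs => rw [← h1]
  rw [prod_image (w.act_injective.injOn)]

theorem single_add_single_inj {i j k l : Fin n} {a b c d : ℤˣ} (hij : i < j) (hkl : k < l)
    (h : (Pi.single i (a : ℤ) + Pi.single j (b : ℤ) : Weight n) =
      Pi.single k (c : ℤ) + Pi.single l (d : ℤ)) : i = k ∧ j = l ∧ a = c ∧ b = d := by
  have e : ∀ m, _ := congrFun h
  simp only [Pi.add_apply, Pi.single_apply] at e
  have ei := e i
  have ej := e j
  have ha := a.ne_zero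
  have hb := b.ne_zero
  have hi : i = k ∨ i = l := by
    by_contra hc
    rw [not_or] at hc
    simp [hc.1, hc.2, hij.ne] at ei
  have hj : j = k ∨ j = l := by
    by_contra hc
    rw [not_or] at hc
    simp [hc.1, hc.2, hij.ne'] at ej
  have hik : i = k := by
    rcases hi with h1 | h1
    · exact h1
    · rcases hj with h2 | h2 <;> subst h1 h2 <;> exact absurd hij (by simp [hkl.le])
  have hjl : j = l := by
    rcases hj with h1 | h1
    · subst hik; exact absurd h1 hij.ne'
    · exact h1
  subst hik hjl
  simp [hij.ne, hij.ne'] at ei ej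
  exact ⟨rfl, rfl, Units.ext ei, Units.ext ej⟩

theorem prod_intUnits {M : Type*} [CommMonoid M] (g : ℤˣ → M) : ∏ a : ℤˣ, g a = g 1 * g (-1) := by
  rw [UnitsInt.univ, prod_pair (by decide)]

theorem roots_eq_union : roots n =
    (univ : Finset (Fin n × ℤˣ)).image (fun p => Pi.single p.1 (2 * (p.2 : ℤ))) ∪
    ((univ : Finset ((Fin n × Fin n) × ℤˣ × ℤˣ)).filter (fun p => p.1.1 < p.1.2)).image
      (fun p => Pi.single p.1.1 (p.2.1 : ℤ) + Pi.single p.1.2 (p.2.2 : ℤ)) := by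
  ext α
  rw [mem_roots]
  simp only [mem_union, mem_image, mem_univ, true_and, mem_filter, Prod.exists]
  refine or_congr Iff.rfl ⟨?_, ?_⟩
  · rintro ⟨i, j, a, b, h, h'⟩
    rcases lt_or_gt_of_ne h with h1 | h1
    · exact ⟨i, j, a, b, h1, h'⟩
    · exact ⟨j, i, b, a, h1, by rw [add_comm]; exact h'⟩
  · rintro ⟨i, j, a, b, h, h'⟩; exact ⟨i, j, a, b, h.ne, h'⟩

theorem two_mul_single_injective :
    Function.Injective (fun p : Fin n × ℤˣ => (Pi.single p.1 (2 * (p.2 : ℤ)) : Weight n)) := by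
  rintro ⟨i, a⟩ ⟨j, b⟩ h
  have e := congrFun h i
  have ha := a.ne_zero
  simp only [Pi.single_apply, if_true] at e
  have hij : i = j := by
    by_contra hc
    simp [hc] at e
  subst hij
  simp at e
  rw [Prod.mk.injEq]
  exact ⟨rfl, Units.ext e⟩

theorem single_ne_single_add_single {i k l : Fin n} {c : ℤ} {a b : ℤˣ} (hkl : k ≠ l) :
    (Pi.single i c : Weight n) ≠ Pi.single k (a : ℤ) + Pi.single l (b : ℤ) := by
  intro h
  have ek := congrFun h k
  have el := congrFun h l
  have ha := a.ne_zero
  have hb := b.ne_zero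
  simp only [Pi.add_apply, Pi.single_apply] at ek el
  simp only [hkl, hkl.symm, if_true, if_false, add_zero, zero_add] at ek el
  by_cases h1 : k = i
  · have h2 : l ≠ i := fun h2 => hkl (h1.trans h2.symm)
    simp only [h2, if_false] at el
    exact hb el.symm
  · simp only [h1, if_false] at ek
    exact ha ek.symm

/-- A product over all roots, with the roots listed by their coordinates. -/
theorem prod_roots {M : Type*} [CommMonoid M] (g : Weight n → M) :
    ∏ α ∈ roots n, g α =
      (∏ i : Fin n, g (Pi.single i 2) * g (Pi.single i (-2))) *
      ∏ i : Fin n, ∏ j ∈ Ioi i, (g (Pi.single i 1 + Pi.single j 1) *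
        g (Pi.single i 1 + Pi.single j (-1))) *
        (g (Pi.single i (-1) + Pi.single j 1) * g (Pi.single i (-1) + Pi.single j (-1))) := by
  rw [roots_eq_union, prod_union, prod_image two_mul_single_injective.injOn, prod_image,
    ← univ_product_univ, prod_product]
  · congr 1
    · refine prod_congr rfl fun i _ => ?_
      rw [prod_intUnits]
      simp
    · rw [prod_filter, ← univ_product_univ, prod_product, ← univ_product_univ, prod_product]
      refine prod_congr rfl fun i _ => ?_
      have : ∀ f : Fin n → M, ∏ j ∈ Ioi i, f j = ∏ j, if i < j then f j else 1 := by
        intro f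
        rw [← prod_filter]
        congr 1
        ext j; simp
      rw [this]
      refine prod_congr rfl fun j _ => ?_
      split_ifs with h
      · rw [← univ_product_univ, prod_product, prod_intUnits, prod_intUnits, prod_intUnits]
        simp
      · simp
  · rintro ⟨⟨i, j⟩, a, b⟩ h1 ⟨⟨k, l⟩, c, d⟩ h2 h
    simp only [coe_filter, mem_univ, true_and, Set.mem_ofPred_eq] at h1 h2
    obtain ⟨rfl, rfl, rfl, rfl⟩ := single_add_single_inj h1 h2 h
    rfl
  · rw [disjoint_left]
    intro α h1 h2
    simp only [mem_image, mem_univ, true_and, mem_filter, Prod.exists] at h1 h2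
    obtain ⟨i, c, rfl⟩ := h1
    obtain ⟨k, l, a, b, hkl, h⟩ := h2
    exact single_ne_single_add_single hkl.ne h.symm

/-- A product over the roots with positive `i`-th coordinate. -/
theorem prod_roots_filter_pos {M : Type*} [CommMonoid M] (i : Fin n) (g : Weight n → M) :
    ∏ α ∈ roots n with 0 < α i, g α =
      g (Pi.single i 2) * ∏ j ∈ univ.erase i, (g (Pi.single i 1 + Pi.single j 1) *
        g (Pi.single i 1 + Pi.single j (-1))) := by
  have h : (roots n).filter (fun α => 0 < α i) = insert (Pi.single i 2)
      (((univ.erase i) ×ˢ (univ : Finset ℤˣ)).image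
        fun p => (Pi.single i 1 + Pi.single p.1 (p.2 : ℤ) : Weight n)) := by
    ext α
    simp only [mem_filter, mem_roots, mem_insert, mem_image, mem_product, mem_erase, mem_univ,
      and_true, Prod.exists]
    constructor
    · rintro ⟨⟨k, a, rfl⟩ | ⟨k, l, a, b, hkl, rfl⟩, h⟩
      · left
        simp only [Pi.single_apply] at h
        split_ifs at h with h1
        · subst h1
          rcases Int.units_eq_one_or a with rfl | rfl
          · simp
          · simp at h
        · exact absurd h (by simp)
      · right
        simp only [Pi.add_apply, Pi.single_apply] at h
        by_cases h1 : i = k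
        · subst h1
          simp only [if_true, hkl, if_false, add_zero] at h
          rcases Int.units_eq_one_or a with rfl | rfl
          · exact ⟨l, b, hkl.symm, by simp⟩
          · simp at h
        · by_cases h2 : i = l
          · subst h2
            simp only [if_true, h1, if_false, zero_add] at h
            rcases Int.units_eq_one_or b with rfl | rfl
            · exact ⟨k, a, hkl, by simp [add_comm]⟩
            · simp at h
          · simp [h1, h2] at h
    · rintro (rfl | ⟨j, b, hj, rfl⟩)
      · exact ⟨Or.inl ⟨i, 1, by simp⟩, by simp⟩
      · exact ⟨Or.inr ⟨i, j, 1, b, hj.symm, by simp⟩, by simp [hj.symm]⟩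
  rw [h, prod_insert, prod_image, prod_product]
  · congr 1
    refine prod_congr rfl fun j _ => ?_
    rw [prod_intUnits]
    simp
  · rintro ⟨j, a⟩ h1 ⟨k, b⟩ h2 h
    simp only [add_right_inj] at h
    have e := congrFun h j
    have ha := a.ne_zero
    simp only [Pi.single_apply, if_true] at e
    have hjk : j = k := by
      by_contra hc
      simp [hc] at e
    subst hjk
    simp at e
    rw [Prod.mk.injEq]
    exact ⟨rfl, Units.ext e⟩
  · simp only [mem_image, mem_product, mem_erase, mem_univ, and_true, Prod.exists, not_exists,
      not_and]
    intro j b hj h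
    exact single_ne_single_add_single (a := 1) hj.symm h.symm

/-! ### Weyl invariance of the kernel -/

theorem isUnit_one_sub_kernel (i : ℕ) (γ : Weight n) :
    IsUnit (1 - tVar (GroupAlg n) * qVar _ ^ i * MvPowerSeries.C (fexp γ)) := by
  refine IsUnit.of_mul_eq_one (MvPowerSeries.invOfUnit
    (1 - tVar (GroupAlg n) * qVar _ ^ i * MvPowerSeries.C (fexp γ)) 1) ?_
  rw [MvPowerSeries.mul_invOfUnit]
  simp [tVar]

theorem map_actAlg_kernelTerm (w : Weyl n) (i : ℕ) (γ : Weight n) :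
    MvPowerSeries.map (w.actAlg : GroupAlg n →+* GroupAlg n) (kernelTerm i γ) =
      kernelTerm i (w.act γ) := by
  have h := congrArg (MvPowerSeries.map (w.actAlg : GroupAlg n →+* GroupAlg n))
    (kernelTerm_mul i γ)
  simp only [map_mul, map_sub, map_one, map_pow, tVar, qVar, MvPowerSeries.map_X,
    MvPowerSeries.map_C, RingHom.coe_coe, Weyl.actAlg_fexp] at h
  exact (isUnit_one_sub_kernel i (w.act γ)).mul_right_cancel
    (h.trans (kernelTerm_mul i (w.act γ)).symm)

theorem isSymm_coeff_macdonaldKernel (m : Fin 2 →₀ ℕ) :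
    IsSymm (MvPowerSeries.coeff m (macdonaldKernel n)) := by
  intro w
  have hf : ∀ i, MvPowerSeries.map (w.actAlg : GroupAlg n →+* GroupAlg n) (kernelFactor n i) =
      kernelFactor n i := by
    intro i
    rw [kernelFactor, map_mul, map_pow, map_prod]
    simp only [map_actAlg_kernelTerm]
    rw [w.prod_roots_act (fun α => kernelTerm i α)]
    congr 3
    exact map_zero w.actHom
  have hdef : MvPowerSeries.coeff m (macdonaldKernel n) =
      MvPowerSeries.coeff m (∏ i ∈ range (m 0 + 1), kernelFactor n i) := rfl
  rw [hdef]
  have h2 := MvPowerSeries.coeff_map (w.actAlg : GroupAlg n →+* GroupAlg n) m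
    (∏ i ∈ range (m 0 + 1), kernelFactor n i)
  rw [map_prod, prod_congr rfl fun i _ => hf i] at h2
  exact h2.symm

/-! ### Alternants as determinants -/

/-- The matrix `(v_i^{k_j} - v'_i^{k_j})`. -/
def symplecticMatrix {R : Type*} [CommRing R] {N : ℕ} (v v' : Fin N → R) (k : Fin N → ℕ) :
    Matrix (Fin N) (Fin N) R :=
  Matrix.of fun i j => v i ^ k j - v' i ^ k j

theorem natDegree_chebyshev_S (R : Type*) [CommRing R] [Nontrivial R] (m : ℕ) :
    (Polynomial.Chebyshev.S R m).natDegree = m ∧ (Polynomial.Chebyshev.S R m).Monic := by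
  induction m using Nat.twoStepInduction with
  | zero => simp [Polynomial.monic_one]
  | one => simp [Polynomial.monic_X]
  | more m h1 h2 =>
    have e : Polynomial.Chebyshev.S R ((m + 2 : ℕ) : ℤ) =
        Polynomial.X * Polynomial.Chebyshev.S R ((m + 1 : ℕ) : ℤ) -
          Polynomial.Chebyshev.S R (m : ℤ) := by
      push_cast
      exact Polynomial.Chebyshev.S_add_two R m
    have hm : (Polynomial.X * Polynomial.Chebyshev.S R ((m + 1 : ℕ) : ℤ)).Monic :=
      Polynomial.monic_X.mul h2.2
    have hd : (Polynomial.X * Polynomial.Chebyshev.S R ((m + 1 : ℕ) : ℤ)).natDegree = m + 2 := by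
      rw [Polynomial.Monic.natDegree_mul Polynomial.monic_X h2.2, h2.1, Polynomial.natDegree_X]
      omega
    have hlt : (Polynomial.Chebyshev.S R (m : ℤ)).natDegree <
        (Polynomial.X * Polynomial.Chebyshev.S R ((m + 1 : ℕ) : ℤ)).natDegree := by
      rw [hd, h1.1]; omega
    rw [e]
    refine ⟨by rw [Polynomial.natDegree_sub_eq_left_of_natDegree_lt hlt, hd], ?_⟩
    refine hm.sub_of_left ?_
    exact Polynomial.degree_lt_degree hlt

theorem eval_chebyshev_S_mul {R : Type*} [CommRing R] {a b : R} (hab : a * b = 1) (m : ℕ) :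
    (Polynomial.Chebyshev.S R m).eval (a + b) * (a - b) = a ^ (m + 1) - b ^ (m + 1) := by
  induction m using Nat.twoStepInduction with
  | zero => simp
  | one => simp; ring
  | more m h1 h2 =>
    have e : Polynomial.Chebyshev.S R ((m + 2 : ℕ) : ℤ) =
        Polynomial.X * Polynomial.Chebyshev.S R ((m + 1 : ℕ) : ℤ) -
          Polynomial.Chebyshev.S R (m : ℤ) := by
      push_cast
      exact Polynomial.Chebyshev.S_add_two R m
    rw [e, Polynomial.eval_sub, Polynomial.eval_mul, Polynomial.eval_X, sub_mul, mul_assoc, h1, h2]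
    linear_combination (a ^ (m + 1) - b ^ (m + 1)) * hab

/-- The Weyl denominator as a Vandermonde determinant in the variables `v_i + v_i⁻¹`. -/
theorem det_symplecticMatrix {R : Type*} [CommRing R] [Nontrivial R] {N : ℕ} {v v' : Fin N → R}
    (hv : ∀ i, v i * v' i = 1) :
    (symplecticMatrix v v' fun j => N - j).det =
      (∏ i, (v i - v' i)) * ∏ i, ∏ j ∈ Ioi i, ((v i + v' i) - (v j + v' j)) := by
  -- After reversal, column `j` holds `v^{j+1} - v'^{j+1} = (v - v') S_j(v + v')` with `S_j` monic
  -- of degree `j`, so a Vandermonde determinant remains.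
  have h1 : ((symplecticMatrix v v' fun j => N - j).submatrix Fin.revPerm Fin.revPerm).det =
      (symplecticMatrix v v' fun j => N - j).det := Matrix.det_submatrix_equiv_self _ _
  have h2 : (symplecticMatrix v v' fun j => N - j).submatrix Fin.revPerm Fin.revPerm =
      Matrix.of fun i j : Fin N => (v (Fin.rev i) - v' (Fin.rev i)) *
        Matrix.of (fun i j : Fin N => (Polynomial.Chebyshev.S R (j : ℕ)).eval
          (v (Fin.rev i) + v' (Fin.rev i))) i j := by
    ext i j
    have hj : N - ((Fin.rev j : Fin N) : ℕ) = j + 1 := by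
      rw [Fin.val_rev]; omega
    simp only [symplecticMatrix, Matrix.submatrix_apply, Matrix.of_apply, Fin.revPerm_apply, hj]
    rw [← eval_chebyshev_S_mul (hv _), mul_comm]
  rw [← h1, h2, Matrix.det_mul_column, ← Matrix.det_eval_matrixOfPolynomials_eq_det_vandermonde
    (fun i : Fin N => v (Fin.rev i) + v' (Fin.rev i))
    (fun j => Polynomial.Chebyshev.S R (j : ℕ)) (fun j => (natDegree_chebyshev_S R j).1)
    (fun j => (natDegree_chebyshev_S R j).2), Matrix.det_vandermonde]
  congr 1
  · exact Equiv.prod_comp Fin.revPerm fun i => v i - v' i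
  · have e : ∀ f : Fin N → Fin N → R, ∏ i, ∏ j ∈ Ioi i, f i j =
        ∏ i, ∏ j, if i < j then f i j else 1 := by
      intro f
      refine prod_congr rfl fun i _ => ?_
      rw [← prod_filter]
      congr 1
      ext j; simp
    rw [e, e, prod_comm, ← Equiv.prod_comp Fin.revPerm]
    refine prod_congr rfl fun i _ => ?_
    rw [← Equiv.prod_comp Fin.revPerm]
    refine prod_congr rfl fun j _ => ?_
    simp only [Fin.revPerm_apply, Fin.rev_lt_rev, Fin.rev_rev]

/-- Expansion of `∏_j (1 - y_j X + X²)` times the Weyl denominator, with `y_j = v_j + v_j⁻¹`, in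
determinants. -/
theorem prod_mul_det_symplecticMatrix {R : Type*} [CommRing R] [Nontrivial R] {N : ℕ}
    {v v' : Fin N → R} (hv : ∀ i, v i * v' i = 1) {X X' : R} (hX : X * X' = 1) :
    (X ^ 2 - 1) * (∏ j, (1 - (v j + v' j) * X + X ^ 2)) *
        (symplecticMatrix v v' fun j => N - j).det =
      ∑ m : Fin (N + 1), (-1) ^ (m : ℕ) * (X ^ (2 * N + 2 - m) - X ^ (m : ℕ)) *
        (symplecticMatrix v v' fun j => N + 1 - (m.succAbove j : ℕ)).det := by
  -- `X` is adjoined as one more variable: the denominator of rank `N + 1` is computed both by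
  -- expansion along the new row and by its product formula.
  have h1 : (symplecticMatrix (Fin.cons X v : Fin (N + 1) → R) (Fin.cons X' v')
      fun j => N + 1 - j).det = ∑ m : Fin (N + 1), (-1) ^ (m : ℕ) *
        (X ^ (N + 1 - (m : ℕ)) - X' ^ (N + 1 - (m : ℕ))) *
        (symplecticMatrix v v' fun j => N + 1 - (m.succAbove j : ℕ)).det := by
    rw [Matrix.det_succ_row_zero]
    rfl
  have h2 := det_symplecticMatrix (N := N + 1) (v := (Fin.cons X v : Fin (N + 1) → R))
    (v' := Fin.cons X' v') (Fin.cases (by simpa using hX) (by simpa using hv))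
  rw [Fin.prod_univ_succ, Fin.prod_univ_succ, Fin.prod_Ioi_zero] at h2
  simp only [Fin.cons_zero, Fin.cons_succ, Fin.prod_Ioi_succ] at h2
  have h3 : (symplecticMatrix (Fin.cons X v : Fin (N + 1) → R) (Fin.cons X' v')
      fun j => N + 1 - j).det = (X - X') * (∏ j, ((X + X') - (v j + v' j))) *
        (symplecticMatrix v v' fun j => N - j).det := by
    rw [h2, det_symplecticMatrix hv]
    ring
  have h4 : ∏ j, (1 - (v j + v' j) * X + X ^ 2) = X ^ N * ∏ j, ((X + X') - (v j + v' j)) := by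
    have : X ^ N = ∏ _j : Fin N, X := by simp
    rw [this, ← prod_mul_distrib]
    refine prod_congr rfl fun j _ => ?_
    linear_combination -hX
  have h5 : (X ^ 2 - 1) * (∏ j, (1 - (v j + v' j) * X + X ^ 2)) *
        (symplecticMatrix v v' fun j => N - j).det = X ^ (N + 1) *
        ((X - X') * (∏ j, ((X + X') - (v j + v' j))) *
        (symplecticMatrix v v' fun j => N - j).det) := by
    rw [h4]
    have : X ^ 2 - 1 = X * (X - X') := by linear_combination hX
    rw [this]; ring
  rw [h5, ← h3, h1, mul_sum]
  refine sum_congr rfl fun m _ => ?_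
  have hm : (m : ℕ) ≤ N + 1 := by omega
  have e1 : X ^ (2 * N + 2 - m) = X ^ (N + 1) * X ^ (N + 1 - (m : ℕ)) := by
    rw [← pow_add]; congr 1; omega
  have e2 : X ^ (N + 1) * X' ^ (N + 1 - (m : ℕ)) = X ^ (m : ℕ) := by
    have h6 : X ^ (N + 1) = X ^ (m : ℕ) * X ^ (N + 1 - (m : ℕ)) := by
      rw [← pow_add]; congr 1; omega
    rw [h6, mul_assoc, ← mul_pow, hX, one_pow, mul_one]
  rw [e1, ← e2]
  ring

/-- The variable `x_i = e^{e_i}`. -/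
def xVar (i : Fin n) : GroupAlg n := fexp (Pi.single i 1)

/-- The inverse variable `x_i⁻¹ = e^{-e_i}`. -/
def xInv (i : Fin n) : GroupAlg n := fexp (Pi.single i (-1))

theorem xVar_mul_xInv (i : Fin n) : xVar i * xInv i = 1 := by
  rw [xVar, xInv, ← fexp_add, ← Pi.single_add, add_neg_cancel, Pi.single_zero, fexp_zero]

theorem fexp_sum {ι : Type*} (s : Finset ι) (f : ι → Weight n) :
    fexp (∑ i ∈ s, f i) = ∏ i ∈ s, fexp (f i) := by
  classical
  induction s using Finset.induction_on with
  | empty => simp [fexp_zero]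
  | insert a s ha ih => rw [sum_insert ha, prod_insert ha, fexp_add, ih]

theorem fexp_eq_prod (μ : Weight n) : fexp μ = ∏ j, fexp (Pi.single j (μ j)) := by
  rw [← fexp_sum]
  congr 1
  ext i
  simp [Finset.sum_apply, Pi.single_apply]

theorem xVar_pow (i : Fin n) (k : ℕ) : xVar i ^ k = fexp (Pi.single i (k : ℤ)) := by
  induction k with
  | zero => simp [fexp_zero]
  | succ k ih => rw [pow_succ, ih, xVar, ← fexp_add, ← Pi.single_add]; simp

theorem xInv_pow (i : Fin n) (k : ℕ) : xInv i ^ k = fexp (Pi.single i (-(k : ℤ))) := by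
  induction k with
  | zero => simp [fexp_zero]
  | succ k ih =>
    rw [pow_succ, ih, xInv, ← fexp_add, ← Pi.single_add]
    congr 2; push_cast; ring

/-- The sum over permutations is the Leibniz expansion; for each permutation the sum over sign
vectors factors into the differences `x_i^k - x_i⁻ᵏ`. -/
theorem alternant_eq_det (k : Fin n → ℕ) :
    alternant (fun j => (k j : ℤ)) = (symplecticMatrix xVar xInv k).det := by
  rw [← Matrix.det_transpose, Matrix.det_apply', alternant, ← univ_product_univ, sum_product]
  refine sum_congr rfl fun σ _ => ?_
  have h : ∏ i, (symplecticMatrix xVar xInv k).transpose (σ i) i =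
      ∏ i, ∑ a : ℤˣ, ((a : ℤ) : GroupAlg n) * fexp (Pi.single i ((a : ℤ) * k (σ i))) := by
    refine prod_congr rfl fun i _ => ?_
    rw [UnitsInt.univ, sum_pair (by decide)]
    simp [symplecticMatrix, xVar_pow, xInv_pow, sub_eq_add_neg]
  rw [h, prod_univ_sum, Fintype.piFinset_univ, mul_sum]
  refine sum_congr rfl fun ε _ => ?_
  rw [prod_mul_distrib, Weyl.sgn, zsmul_eq_mul, fexp_eq_prod (Weyl.act _ _)]
  simp only [Weyl.act, Units.val_mul, Int.cast_mul, Units.coe_prod, Int.cast_prod]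
  rw [mul_assoc]

theorem rho_eq : rho n = fun j : Fin n => ((n - (j : ℕ) : ℕ) : ℤ) := by
  ext j
  have := j.2
  simp only [rho]
  omega

theorem alternant_rho_eq_det :
    alternant (rho n) = (symplecticMatrix xVar xInv fun j : Fin n => n - (j : ℕ)).det := by
  rw [rho_eq, alternant_eq_det]

theorem fundamentalWeight_add_rho (m : Fin (n + 1)) :
    (fundamentalWeight n m).1 + rho n = fun j => ((n + 1 - (m.succAbove j : ℕ) : ℕ) : ℤ) := by
  ext j
  have := j.2
  simp only [fundamentalWeight, rho, Pi.add_apply]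
  rcases lt_or_ge (j : ℕ) m with h | h
  · rw [Fin.succAbove_of_castSucc_lt _ _ (by simpa [Fin.lt_def] using h)]
    simp [h]
    omega
  · rw [Fin.succAbove_of_le_castSucc _ _ (by simpa [Fin.le_def] using h)]
    simp [not_lt.2 h]

theorem one_sub_mul_one_sub_xVar (i j : Fin n) :
    (1 - xVar i * xVar j) * (1 - xVar i * xInv j) =
      xVar i * ((xVar i + xInv i) - (xVar j + xInv j)) := by
  linear_combination xVar i ^ 2 * xVar_mul_xInv j - xVar_mul_xInv i

/-- Weyl's denominator formula: the square of the denominator is, up to sign, the product of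
`1 - e^α` over the roots. -/
theorem prod_one_sub_fexp_roots :
    ∏ α ∈ roots n, (1 - fexp α) = (-1) ^ n * alternant (rho n) ^ 2 := by
  rw [prod_roots, alternant_rho_eq_det, det_symplecticMatrix (v := (xVar : Fin n → _)) xVar_mul_xInv]
  have h1 : ∀ i : Fin n, (1 - fexp (Pi.single i 2 : Weight n)) * (1 - fexp (Pi.single i (-2))) =
      -1 * (xVar i - xInv i) ^ 2 := by
    intro i
    have e1 := xVar_pow i 2
    have e2 := xInv_pow i 2
    push_cast at e1 e2
    rw [← e1, ← e2]
    linear_combination (xVar i * xInv i - 1) * xVar_mul_xInv i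
  have h2 : ∀ i j : Fin n, ((1 - fexp (Pi.single i 1 + Pi.single j 1 : Weight n)) *
        (1 - fexp (Pi.single i 1 + Pi.single j (-1)))) *
        ((1 - fexp (Pi.single i (-1) + Pi.single j 1)) *
          (1 - fexp (Pi.single i (-1) + Pi.single j (-1)))) =
      ((xVar i + xInv i) - (xVar j + xInv j)) ^ 2 := by
    intro i j
    simp only [fexp_add]
    change ((1 - xVar i * xVar j) * (1 - xVar i * xInv j)) *
      ((1 - xInv i * xVar j) * (1 - xInv i * xInv j)) = _
    have e : (1 - xInv i * xVar j) * (1 - xInv i * xInv j) =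
        xInv i * ((xVar i + xInv i) - (xVar j + xInv j)) := by
      linear_combination xInv i ^ 2 * xVar_mul_xInv j - xVar_mul_xInv i
    rw [one_sub_mul_one_sub_xVar, e]
    linear_combination ((xVar i + xInv i) - (xVar j + xInv j)) ^ 2 * xVar_mul_xInv i
  simp only [h1, h2, prod_mul_distrib, prod_pow]
  simp
  ring

/-- The generating polynomial `∏_j (1 - x_j X)(1 - x_j⁻¹ X)` of the (signed) characters of the
exterior powers of the vector representation. -/
def extPoly (n : ℕ) : Polynomial (GroupAlg n) :=
  ∏ j : Fin n, (1 - Polynomial.C (xVar j) * Polynomial.X) *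
    (1 - Polynomial.C (xInv j) * Polynomial.X)

theorem extPoly_mul_alternant_rho :
    (Polynomial.X ^ 2 - 1) * extPoly n * Polynomial.C (alternant (rho n)) =
      ∑ m : Fin (n + 1), (-1) ^ (m : ℕ) *
        (Polynomial.X ^ (2 * n + 2 - m) - Polynomial.X ^ (m : ℕ)) *
        Polynomial.C (alternant ((fundamentalWeight n m).1 + rho n)) := by
  -- The determinant expansion needs an inverse of `X`, so it is applied in a field of fractions and
  -- pulled back.
  let K := FractionRing (Polynomial (GroupAlg n))
  let φ : GroupAlg n →+* K := (algebraMap (Polynomial (GroupAlg n)) K).comp Polynomial.C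
  have hinj : Function.Injective (algebraMap (Polynomial (GroupAlg n)) K) :=
    FaithfulSMul.algebraMap_injective _ _
  have hX : algebraMap (Polynomial (GroupAlg n)) K Polynomial.X ≠ 0 := by
    rw [Ne, map_eq_zero_iff _ hinj]
    exact Polynomial.X_ne_zero
  have hv : ∀ i : Fin n, φ (xVar i) * φ (xInv i) = 1 := by
    intro i
    rw [← map_mul, xVar_mul_xInv, map_one]
  have h := prod_mul_det_symplecticMatrix hv (mul_inv_cancel₀ hX)
  have hdet : ∀ k : Fin n → ℕ, (symplecticMatrix (fun i => φ (xVar i)) (fun i => φ (xInv i)) k).det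
      = φ (alternant fun j => (k j : ℤ)) := by
    intro k
    rw [alternant_eq_det, RingHom.map_det]
    congr 1
    ext i j
    simp [symplecticMatrix]
  apply hinj
  simp only [fundamentalWeight_add_rho]
  rw [map_sum, map_mul, map_mul, rho_eq]
  simp only [hdet] at h
  have e1 : algebraMap (Polynomial (GroupAlg n)) K (extPoly n) =
      ∏ j, (1 - (φ (xVar j) + φ (xInv j)) * algebraMap (Polynomial (GroupAlg n)) K Polynomial.X +
        algebraMap (Polynomial (GroupAlg n)) K Polynomial.X ^ 2) := by
    rw [extPoly, map_prod]
    refine prod_congr rfl fun j _ => ?_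
    have := hv j
    simp only [φ, RingHom.comp_apply, map_mul, map_sub, map_one] at this ⊢
    linear_combination algebraMap (Polynomial (GroupAlg n)) K Polynomial.X ^ 2 * this
  rw [e1]
  simp only [map_mul, map_sub, map_pow, map_one, map_neg]
  exact h

/-- This is `Λ^{r+2}V - Λ^r V = χ(ω_{r+2})` for the vector representation `V`, up to sign. The
powers `X^{2n+2-m}` have exponent at least `n + 2`, so in degree `r + 2 ≤ n` only the term `m = r +
2` survives. -/
theorem coeff_extPoly_sub_mul_alternant (r : ℕ) (hr : r + 2 ≤ n) :
    ((extPoly n).coeff (r + 2) - (extPoly n).coeff r) * alternant (rho n) =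
      (-1) ^ r * alternant ((fundamentalWeight n (r + 2)).1 + rho n) := by
  have h := congrArg (fun p => Polynomial.coeff p (r + 2)) (extPoly_mul_alternant_rho (n := n))
  simp only [Polynomial.coeff_mul_C, sub_mul, one_mul, Polynomial.coeff_sub,
    Polynomial.coeff_X_pow_mul, Polynomial.finsetSum_coeff] at h
  rw [sum_eq_single (⟨r + 2, by omega⟩ : Fin (n + 1))] at h
  · have e : ((-1 : Polynomial (GroupAlg n)) ^ (r + 2)) = Polynomial.C ((-1) ^ (r + 2)) := by simp
    simp only [mul_sub, e, Polynomial.coeff_sub, Polynomial.coeff_C_mul,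
      Polynomial.coeff_X_pow] at h
    have h3 : ¬ (r + 2 = 2 * n + 2 - (r + 2)) := by omega
    simp only [h3, if_true, if_false] at h
    linear_combination -h
  · rintro m - hm
    have e : ((-1 : Polynomial (GroupAlg n)) ^ (m : ℕ)) = Polynomial.C ((-1) ^ (m : ℕ)) := by simp
    have h2 : ¬ (r + 2 = (m : ℕ)) := fun h => hm (Fin.ext h.symm)
    have h3 : ¬ (r + 2 = 2 * n + 2 - (m : ℕ)) := by omega
    simp only [mul_sub, e, Polynomial.coeff_sub, Polynomial.coeff_C_mul, Polynomial.coeff_X_pow,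
      h2, h3, if_false]
    simp
  · simp

theorem coeff_zero_extPoly : (extPoly n).coeff 0 = 1 := by
  rw [Polynomial.coeff_zero_eq_eval_zero, extPoly, Polynomial.eval_prod]
  simp

/-! ### The weight function at `t = q^s` and its `q`-difference property -/

/-- The product of `1 - Q^m e^α` over the roots `α` and `0 ≤ m < s`. -/
def weightPoly (n : ℕ) (Q : GroupAlg n) (s : ℕ) : GroupAlg n :=
  ∏ α ∈ roots n, ∏ m ∈ range s, (1 - Q ^ m * fexp α)

/-- The product of `1 - Q^{m + max(0, α_i)} e^α` over the roots `α` and `0 ≤ m < s`. -/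
def shiftedWeight (Q : GroupAlg n) (s : ℕ) (i : Fin n) : GroupAlg n :=
  ∏ α ∈ roots n, ∏ m ∈ range s, (1 - Q ^ (m + (α i).toNat) * fexp α)

/-- The image of `shiftedWeight` under the inversion of all variables. -/
def shiftedWeightInv (Q : GroupAlg n) (s : ℕ) (i : Fin n) : GroupAlg n :=
  ∏ α ∈ roots n, ∏ m ∈ range s, (1 - Q ^ (m + (α i).toNat) * fexp (-α))

theorem prod_roots_neg {M : Type*} [CommMonoid M] (g : Weight n → M) :
    ∏ α ∈ roots n, g (-α) = ∏ α ∈ roots n, g α := by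
  have h := Weyl.prod_roots_act (1, -1) g
  have e : ∀ α : Weight n, Weyl.act (1, -1) α = -α := by
    intro α; ext j; simp [Weyl.act]
  simpa only [e] using h

theorem shiftedWeightInv_eq (Q : GroupAlg n) (s : ℕ) (i : Fin n) :
    shiftedWeightInv Q s i =
      ∏ α ∈ roots n, ∏ m ∈ range s, (1 - Q ^ (m + (-α i).toNat) * fexp α) := by
  rw [← prod_roots_neg, shiftedWeightInv]
  simp

theorem weightPoly_eq_prod_neg (Q : GroupAlg n) (s : ℕ) :
    weightPoly n Q s = ∏ α ∈ roots n, ∏ m ∈ range s, (1 - Q ^ m * fexp (-α)) := by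
  rw [prod_roots_neg (fun α => ∏ m ∈ range s, (1 - Q ^ m * fexp α)), weightPoly]

/-- Both sides are the product over `m < s + d`, split at `d` and at `s`. -/
theorem prod_range_shift {R : Type*} [CommRing R] (Q e : R) (s d : ℕ) :
    (∏ m ∈ range s, (1 - Q ^ (m + d) * e)) * ∏ m ∈ range d, (1 - Q ^ m * e) =
      (∏ m ∈ range s, (1 - Q ^ m * e)) * ∏ m ∈ range d, (1 - Q ^ s * Q ^ m * e) := by
  have h1 := prod_range_add (fun m => 1 - Q ^ m * e) d s
  have h2 := prod_range_add (fun m => 1 - Q ^ m * e) s d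
  rw [add_comm d s, h2] at h1
  simp only [← pow_add]
  rw [h1, mul_comm]
  simp only [add_comm]

/-- Only the roots with positive `i`-th coordinate, `2e_i` and `e_i ± e_j`, are affected by the
shift, by 2 and 1 steps respectively. The function `e` is left free so as to cover both `e^α` and
`e^{-α}`. -/
theorem prod_roots_shift {R : Type*} [CommRing R] (Q : R) (s : ℕ) (i : Fin n)
    (e : Weight n → R) :
    (∏ α ∈ roots n, ∏ m ∈ range s, (1 - Q ^ (m + (α i).toNat) * e α)) *
      (((1 - e (Pi.single i 2)) * (1 - Q * e (Pi.single i 2))) *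
        ∏ j ∈ univ.erase i, ((1 - e (Pi.single i 1 + Pi.single j 1)) *
          (1 - e (Pi.single i 1 + Pi.single j (-1))))) =
    (∏ α ∈ roots n, ∏ m ∈ range s, (1 - Q ^ m * e α)) *
      (((1 - Q ^ s * e (Pi.single i 2)) * (1 - Q ^ s * Q * e (Pi.single i 2))) *
        ∏ j ∈ univ.erase i, ((1 - Q ^ s * e (Pi.single i 1 + Pi.single j 1)) *
          (1 - Q ^ s * e (Pi.single i 1 + Pi.single j (-1))))) := by
  have key : ∀ c : R, ∏ α ∈ roots n, ∏ m ∈ range (α i).toNat, (1 - c * Q ^ m * e α) =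
      ((1 - c * e (Pi.single i 2)) * (1 - c * Q * e (Pi.single i 2))) *
        ∏ j ∈ univ.erase i, ((1 - c * e (Pi.single i 1 + Pi.single j 1)) *
          (1 - c * e (Pi.single i 1 + Pi.single j (-1)))) := by
    intro c
    have h := prod_filter_mul_prod_filter_not (roots n) (fun α => 0 < α i)
      fun α => ∏ m ∈ range (α i).toNat, (1 - c * Q ^ m * e α)
    have h2 : ∏ α ∈ roots n with ¬ 0 < α i,
        ∏ m ∈ range (α i).toNat, (1 - c * Q ^ m * e α) = 1 := by
      refine prod_eq_one fun α hα => ?_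
      have h3 := (mem_filter.1 hα).2
      rw [Int.toNat_of_nonpos (not_lt.1 h3), range_zero, prod_empty]
    rw [h2, mul_one, prod_roots_filter_pos] at h
    rw [← h]
    refine congrArg₂ (· * ·) ?_ ?_
    · have : ((Pi.single i 2 : Weight n) i).toNat = 2 := by simp
      rw [this, prod_range_succ, prod_range_one, pow_zero, pow_one, mul_one]
    · refine prod_congr rfl fun j hj => ?_
      have hij : i ≠ j := (ne_of_mem_erase hj).symm
      have h3 : ∀ a : ℤ, ((Pi.single i 1 + Pi.single j a : Weight n) i).toNat = 1 := by
        intro a; simp [hij]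
      rw [h3, h3, prod_range_one, prod_range_one, pow_zero, mul_one]
  have k1 := key 1
  have k2 := key (Q ^ s)
  simp only [one_mul] at k1
  rw [← k1, ← k2, ← prod_mul_distrib, ← prod_mul_distrib]
  exact prod_congr rfl fun α _ => prod_range_shift _ _ _ _

theorem shiftedWeight_mul (Q : GroupAlg n) (s : ℕ) (i : Fin n) :
    shiftedWeight Q s i * (((1 - xVar i ^ 2) * (1 - Q * xVar i ^ 2)) *
        ∏ j ∈ univ.erase i, ((1 - xVar j * xVar i) * (1 - xInv j * xVar i))) =
      weightPoly n Q s *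
        (((1 - Q ^ s * xVar i ^ 2) * (1 - Q ^ s * Q * xVar i ^ 2)) *
        ∏ j ∈ univ.erase i, ((1 - Q ^ s * (xVar j * xVar i)) *
          (1 - Q ^ s * (xInv j * xVar i)))) := by
  have h := prod_roots_shift Q s i fexp
  have e1 := xVar_pow i 2
  push_cast at e1
  simp only [fexp_add, ← e1] at h
  simp only [shiftedWeight, weightPoly, mul_comm (xVar _) (xVar i), mul_comm (xInv _) (xVar i)]
  exact h

theorem shiftedWeightInv_mul (Q : GroupAlg n) (s : ℕ) (i : Fin n) :
    shiftedWeightInv Q s i * (((1 - xInv i ^ 2) * (1 - Q * xInv i ^ 2)) *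
        ∏ j ∈ univ.erase i, ((1 - xVar j * xInv i) * (1 - xInv j * xInv i))) =
      weightPoly n Q s *
        (((1 - Q ^ s * xInv i ^ 2) * (1 - Q ^ s * Q * xInv i ^ 2)) *
        ∏ j ∈ univ.erase i, ((1 - Q ^ s * (xVar j * xInv i)) *
          (1 - Q ^ s * (xInv j * xInv i)))) := by
  have h := prod_roots_shift Q s i fun α => fexp (-α)
  have e1 := xInv_pow i 2
  push_cast at e1
  simp only [neg_add, ← Pi.single_neg, neg_neg, fexp_add, ← e1] at h
  rw [weightPoly_eq_prod_neg]
  simp only [shiftedWeightInv, mul_comm (xVar _) (xInv i), mul_comm (xInv _) (xInv i)]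
  simp only [mul_comm (1 - xInv i * xVar _), mul_comm (1 - Q ^ s * (xInv i * xVar _))]
  exact h

/-- The algebra endomorphism `x_i ↦ q x_i`. -/
def qShift (q : ℂˣ) (i : Fin n) : GroupAlg n →ₐ[ℂ] GroupAlg n :=
  AddMonoidAlgebra.lift ℂ (GroupAlg n) (Weight n)
    { toFun := fun μ => algebraMap ℂ (GroupAlg n) ((q ^ (μ.toAdd i) : ℂˣ) : ℂ) * fexp μ.toAdd
      map_one' := by
        rw [toAdd_one, Pi.zero_apply, zpow_zero, Units.val_one, map_one, one_mul, fexp_zero]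
      map_mul' := fun μ ν => by
        simp only [toAdd_mul, Pi.add_apply, zpow_add, Units.val_mul, map_mul, fexp_add]
        ring }

theorem qShift_fexp (q : ℂˣ) (i : Fin n) (μ : Weight n) :
    qShift q i (fexp μ) = algebraMap ℂ (GroupAlg n) ((q ^ (μ i) : ℂˣ) : ℂ) * fexp μ := by
  exact (AddMonoidAlgebra.lift_single _ μ (1 : ℂ)).trans (one_smul ℂ _)

theorem groupAlg_linearMap_ext {M : Type*} [AddCommMonoid M] [Module ℂ M]
    {f g : GroupAlg n →ₗ[ℂ] M} (h : ∀ μ, f (fexp μ) = g (fexp μ)) : f = g := by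
  refine LinearMap.ext fun x => ?_
  refine AddMonoidAlgebra.induction_linear x (by simp) (fun x y hx hy => ?_) fun μ c => ?_
  · rw [map_add, map_add, hx, hy]
  · have : AddMonoidAlgebra.single μ c = c • fexp μ := by simp [fexp]
    rw [this, map_smul, map_smul, h]

theorem qShift_qShift_inv (q : ℂˣ) (i : Fin n) (f : GroupAlg n) :
    qShift q i (qShift q⁻¹ i f) = f := by
  have h : (qShift q i).toLinearMap.comp (qShift q⁻¹ i).toLinearMap = LinearMap.id := by
    refine groupAlg_linearMap_ext fun μ => ?_
    change qShift q i (qShift q⁻¹ i (fexp μ)) = fexp μ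
    rw [qShift_fexp, map_mul, qShift_fexp, AlgHom.commutes, ← mul_assoc, ← map_mul,
      ← Units.val_mul, inv_zpow, inv_mul_cancel, Units.val_one, map_one, one_mul]
  exact congrArg (fun g : GroupAlg n →ₗ[ℂ] GroupAlg n => g f) h

/-- The constant term. -/
def constTerm : GroupAlg n →ₗ[ℂ] ℂ where
  toFun f := f.coeff 0
  map_add' f g := by simp
  map_smul' c f := by simp

theorem constTerm_algebraMap_mul (c : ℂ) (f : GroupAlg n) :
    constTerm (algebraMap ℂ (GroupAlg n) c * f) = c * constTerm f := by
  rw [← Algebra.smul_def, map_smul, smul_eq_mul]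

theorem constTerm_qShift (q : ℂˣ) (i : Fin n) (f : GroupAlg n) :
    constTerm (qShift q i f) = constTerm f := by
  have h : constTerm.comp (qShift q i).toLinearMap = constTerm := by
    refine groupAlg_linearMap_ext fun μ => ?_
    change constTerm (qShift q i (fexp μ)) = constTerm (fexp μ)
    rw [qShift_fexp, constTerm_algebraMap_mul]
    change _ * (fexp μ).coeff 0 = (fexp μ).coeff 0
    rw [coeff_fexp]
    split_ifs with h
    · simp [h]
    · simp
  exact congrArg (fun g : GroupAlg n →ₗ[ℂ] ℂ => g f) h

/-- The shift multiplies `e^α` by `q^{α_i}`, and `max(0, -α_i) + α_i = max(0, α_i)`. -/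
theorem qShift_shiftedWeightInv (q : ℂˣ) (s : ℕ) (i : Fin n) :
    qShift q i (shiftedWeightInv (algebraMap ℂ _ (q : ℂ)) s i) =
      shiftedWeight (algebraMap ℂ _ (q : ℂ)) s i := by
  rw [shiftedWeightInv_eq, shiftedWeight, map_prod]
  refine prod_congr rfl fun α _ => ?_
  rw [map_prod]
  refine prod_congr rfl fun m _ => ?_
  rw [map_sub, map_one, map_mul, map_pow, AlgHom.commutes, qShift_fexp, ← mul_assoc, ← map_pow,
    ← map_pow, ← map_mul, ← Units.val_pow_eq_pow_val, ← Units.val_pow_eq_pow_val,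
    ← Units.val_mul, ← zpow_natCast, ← zpow_natCast, ← zpow_add]
  congr 6
  push_cast
  rcases le_total 0 (α i) with h | h <;> simp [h]

/-- As `T_i` carries `B_i'` to `B_i` and preserves constant terms, `CT(B_i T_i f) = CT(B_i' f)` and
`CT(B_i' T_i⁻¹ f) = CT(B_i f)`; the four terms cancel. -/
theorem constTerm_qShift_sub (q : ℂˣ) (s : ℕ) (i : Fin n) (f : GroupAlg n) :
    constTerm (shiftedWeight (algebraMap ℂ _ (q : ℂ)) s i * (qShift q i f - f) +
      shiftedWeightInv (algebraMap ℂ _ (q : ℂ)) s i * (qShift q⁻¹ i f - f)) = 0 := by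
  have h1 : constTerm (shiftedWeight (algebraMap ℂ _ (q : ℂ)) s i * qShift q i f) =
      constTerm (shiftedWeightInv (algebraMap ℂ _ (q : ℂ)) s i * f) := by
    rw [← qShift_shiftedWeightInv, ← map_mul, constTerm_qShift]
  have h2 : constTerm (shiftedWeightInv (algebraMap ℂ _ (q : ℂ)) s i * qShift q⁻¹ i f) =
      constTerm (shiftedWeight (algebraMap ℂ _ (q : ℂ)) s i * f) := by
    rw [← constTerm_qShift q i, map_mul, qShift_shiftedWeightInv, qShift_qShift_inv]
  rw [mul_sub, mul_sub, map_add, map_sub, map_sub, h1, h2]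
  ring

/-- The generating polynomial with the variable `x_i` left out. -/
def extPolyOmit (i : Fin n) : Polynomial (GroupAlg n) :=
  ∏ j ∈ univ.erase i, (1 - Polynomial.C (xVar j) * Polynomial.X) *
    (1 - Polynomial.C (xInv j) * Polynomial.X)

theorem extPoly_eq_mul_omit (i : Fin n) :
    extPoly n = ((1 - Polynomial.C (xVar i) * Polynomial.X) *
      (1 - Polynomial.C (xInv i) * Polynomial.X)) * extPolyOmit i :=
  (mul_prod_erase univ _ (mem_univ i)).symm

theorem qShift_xVar (q : ℂˣ) (i : Fin n) :
    qShift q i (xVar i) = algebraMap ℂ _ (q : ℂ) * xVar i := by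
  simp [xVar, qShift_fexp]

theorem qShift_xInv (q : ℂˣ) (i : Fin n) :
    qShift q i (xInv i) = algebraMap ℂ _ ((q⁻¹ : ℂˣ) : ℂ) * xInv i := by
  rw [xInv, qShift_fexp]
  simp

theorem map_qShift_extPoly (q : ℂˣ) (i : Fin n) :
    (extPoly n).map (qShift q i : GroupAlg n →+* GroupAlg n) =
      ((1 - Polynomial.C (algebraMap ℂ _ (q : ℂ) * xVar i) * Polynomial.X) *
      (1 - Polynomial.C (algebraMap ℂ _ ((q⁻¹ : ℂˣ) : ℂ) * xInv i) * Polynomial.X)) *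
        extPolyOmit i := by
  rw [extPoly_eq_mul_omit i, Polynomial.map_mul, Polynomial.map_mul, extPolyOmit,
    Polynomial.map_prod]
  congr 1
  · simp [qShift_xVar, qShift_xInv]
  · refine prod_congr rfl fun j hj => ?_
    have hij : j ≠ i := ne_of_mem_erase hj
    have h1 : qShift q i (xVar j) = xVar j := by
      simp [xVar, qShift_fexp, hij, -AddMonoidAlgebra.coe_algebraMap]
    have h2 : qShift q i (xInv j) = xInv j := by
      simp [xInv, qShift_fexp, hij, -AddMonoidAlgebra.coe_algebraMap]
    simp [h1, h2]

/-- The coefficient of the `i`-th summand of the interpolation formula. -/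
def nodeWeight (Q : GroupAlg n) (s : ℕ) (i : Fin n) : GroupAlg n :=
  shiftedWeight Q s i * (xInv i * (1 - Q * xVar i ^ 2)) +
    shiftedWeightInv Q s i * (xVar i * (1 - Q * xInv i ^ 2))

theorem constTerm_coeff_omit (q : ℂˣ) (hq : (q : ℂ) ≠ 1) (s : ℕ) (i : Fin n) (r : ℕ) :
    constTerm ((Polynomial.X * extPolyOmit i *
      Polynomial.C (nodeWeight (algebraMap ℂ _ (q : ℂ)) s i)).coeff r) = 0 := by
  have h := constTerm_qShift_sub q s i ((extPoly n).coeff r)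
  have hc : ∀ p : ℂˣ, qShift p i ((extPoly n).coeff r) =
      ((extPoly n).map (qShift p i : GroupAlg n →+* GroupAlg n)).coeff r := by
    intro p; rw [Polynomial.coeff_map]; rfl
  have hx := congrArg Polynomial.C (xVar_mul_xInv i)
  have hqq : (Polynomial.C (algebraMap ℂ (GroupAlg n) (q : ℂ))) *
      Polynomial.C (algebraMap ℂ (GroupAlg n) ((q⁻¹ : ℂˣ) : ℂ)) = 1 := by
    rw [← map_mul, ← map_mul, Units.mul_inv, map_one, map_one]
  rw [map_mul, map_one] at hx
  rw [hc, hc, ← Polynomial.coeff_sub, ← Polynomial.coeff_sub, ← Polynomial.coeff_C_mul,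
    ← Polynomial.coeff_C_mul, ← Polynomial.coeff_add] at h
  -- Only the factors in `x_i^{±1}` move, and `(1 - q x X)(1 - q⁻¹ x⁻¹ X) - (1 - x X)(1 - x⁻¹ X) =
  -- (q - 1) q⁻¹ X (x⁻¹ - q x)`. The inverse shift gives the same with `x` and `x⁻¹` exchanged, so
  -- the scalar `(q - 1) q⁻¹` is common; it is nonzero and can be cancelled.
  have key : Polynomial.C (shiftedWeight (algebraMap ℂ _ (q : ℂ)) s i) *
        ((extPoly n).map (qShift q i : GroupAlg n →+* GroupAlg n) - extPoly n) +
      Polynomial.C (shiftedWeightInv (algebraMap ℂ _ (q : ℂ)) s i) *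
        ((extPoly n).map (qShift q⁻¹ i : GroupAlg n →+* GroupAlg n) - extPoly n) =
      Polynomial.C (algebraMap ℂ _ (((q : ℂ) - 1) * ((q⁻¹ : ℂˣ) : ℂ))) *
      (Polynomial.X * extPolyOmit i *
      Polynomial.C (nodeWeight (algebraMap ℂ _ (q : ℂ)) s i)) := by
    rw [map_qShift_extPoly, map_qShift_extPoly, extPoly_eq_mul_omit i, inv_inv, nodeWeight]
    simp only [map_mul, map_sub, map_add, map_one, map_pow]
    generalize Polynomial.C (algebraMap ℂ (GroupAlg n) (q : ℂ)) = Q at *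
    generalize Polynomial.C (algebraMap ℂ (GroupAlg n) ((q⁻¹ : ℂˣ) : ℂ)) = Q' at *
    generalize (Polynomial.C (xVar i) : Polynomial (GroupAlg n)) = x at *
    generalize (Polynomial.C (xInv i) : Polynomial (GroupAlg n)) = x' at *
    generalize Polynomial.C (shiftedWeight _ s i) = B at *
    generalize Polynomial.C (shiftedWeightInv _ s i) = B' at *
    generalize extPolyOmit i = H at *
    have e1 : (1 - Q * x * Polynomial.X) * (1 - Q' * x' * Polynomial.X) * H -
        (1 - x * Polynomial.X) * (1 - x' * Polynomial.X) * H =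
        (Q - 1) * Q' * (Polynomial.X * H * (x' * (1 - Q * x ^ 2))) := by
      linear_combination (Polynomial.X ^ 2 * H * x * x' - Polynomial.X * H * x' +
        (Q - 1) * Polynomial.X * H * x' * x ^ 2) * hqq + (Q - 1) * Polynomial.X * H * x * hx
    have e2 : (1 - Q' * x * Polynomial.X) * (1 - Q * x' * Polynomial.X) * H -
        (1 - x * Polynomial.X) * (1 - x' * Polynomial.X) * H =
        (Q - 1) * Q' * (Polynomial.X * H * (x * (1 - Q * x' ^ 2))) := by
      linear_combination (Polynomial.X ^ 2 * H * x * x' - Polynomial.X * H * x +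
        (Q - 1) * Polynomial.X * H * x * x' ^ 2) * hqq + (Q - 1) * Polynomial.X * H * x' * hx
    rw [e1, e2]
    ring
  rw [key, Polynomial.coeff_C_mul, constTerm_algebraMap_mul] at h
  refine (mul_eq_zero.1 h).resolve_left (mul_ne_zero (sub_ne_zero.2 hq) (Units.ne_zero _))

/-! ### The interpolation formula -/

theorem eval_extPoly (z : GroupAlg n) :
    (extPoly n).eval z = ∏ j, (1 - xVar j * z) * (1 - xInv j * z) := by
  simp [extPoly, Polynomial.eval_prod]

theorem eval_extPolyOmit (i : Fin n) (z : GroupAlg n) :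
    (extPolyOmit i).eval z = ∏ j ∈ univ.erase i, (1 - xVar j * z) * (1 - xInv j * z) := by
  simp [extPolyOmit, Polynomial.eval_prod]

theorem factor_reverse (j : Fin n) {a b : GroupAlg n} (hab : a * b = 1) :
    (1 - xVar j * a) * (1 - xInv j * a) = a ^ 2 * ((1 - xVar j * b) * (1 - xInv j * b)) := by
  linear_combination (a ^ 2 - a ^ 2 * b ^ 2) * xVar_mul_xInv j +
    ((xVar j + xInv j) * a - a * b - 1) * hab

/-- The value of the interpolation formula at a node, in terms of the node `a` and its inverse
`b`. -/
theorem node_identity {R : Type*} [CommRing R] {Q τ τ' a b B B' W D D' N N' : R} (k : ℕ)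
    (hab : a * b = 1) (hτ : τ * τ' = 1)
    (hB : B * (((1 - a ^ 2) * (1 - Q * a ^ 2)) * D) =
      W * (((1 - τ * a ^ 2) * (1 - τ * Q * a ^ 2)) * N))
    (hB' : B' * (((1 - b ^ 2) * (1 - Q * b ^ 2)) * D') =
      W * (((1 - τ * b ^ 2) * (1 - τ * Q * b ^ 2)) * N'))
    (hD : D = (a ^ 2) ^ k * D') :
    τ' ^ (k + 1) * (1 - τ) * ((1 - a ^ 2) * (a * D *
        (B * (b * (1 - Q * a ^ 2)) + B' * (a * (1 - Q * b ^ 2))))) =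
      W * ((1 - Q * τ * a ^ 2) * (τ' ^ (k + 1) * ((1 - τ) * (1 - τ * a ^ 2) * N)) -
        (a ^ 2 - Q * τ) * (τ ^ (k + 1) * ((τ' ^ 2 * a ^ 2) ^ (k + 1) *
          ((1 - τ * b ^ 2) * (1 - τ) * N')))) := by
  have e1 : (1 - a ^ 2) * (a * D * (B * (b * (1 - Q * a ^ 2)))) =
      W * (((1 - τ * a ^ 2) * (1 - τ * Q * a ^ 2)) * N) := by
    rw [← hB]
    linear_combination (1 - a ^ 2) * D * B * (1 - Q * a ^ 2) * hab
  have e2 : (1 - a ^ 2) * (a * D * (B' * (a * (1 - Q * b ^ 2)))) =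
      -(a ^ 2) ^ (k + 2) * (W * (((1 - τ * b ^ 2) * (1 - τ * Q * b ^ 2)) * N')) := by
    rw [← hB', hD, pow_add]
    generalize (a ^ 2) ^ k = A
    linear_combination (-(a ^ 2 * A * D' * B' * (1 - Q * b ^ 2) * (a * b + 1))) * hab
  have e3 : τ ^ (k + 1) * (τ' ^ 2 * a ^ 2) ^ (k + 1) = τ' ^ (k + 1) * (a ^ 2) ^ (k + 1) := by
    have h0 : τ * (τ' ^ 2 * a ^ 2) = τ' * a ^ 2 := by linear_combination τ' * a ^ 2 * hτ
    rw [← mul_pow, h0, mul_pow]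
  have e4 : a ^ 2 - Q * τ = a ^ 2 * (1 - τ * Q * b ^ 2) := by
    linear_combination Q * τ * (a * b + 1) * hab
  have e5 : τ ^ (k + 1) * ((τ' ^ 2 * a ^ 2) ^ (k + 1) * ((1 - τ * b ^ 2) * (1 - τ) * N')) =
      τ' ^ (k + 1) * (a ^ 2) ^ (k + 1) * ((1 - τ * b ^ 2) * (1 - τ) * N') := by
    rw [← mul_assoc, e3]
  rw [e5, e4]
  linear_combination τ' ^ (k + 1) * (1 - τ) * (e1 + e2)

/-- The difference between the two sides of the interpolation formula. -/
def interpPoly (n : ℕ) (Q τ' : GroupAlg n) (s : ℕ) : Polynomial (GroupAlg n) :=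
  Polynomial.C (τ' ^ n * (1 - Q ^ s)) * ((1 - Polynomial.X ^ 2) *
      ∑ i, Polynomial.X * extPolyOmit i * Polynomial.C (nodeWeight Q s i)) -
    Polynomial.C (weightPoly n Q s) *
      ((1 - Polynomial.C (Q * Q ^ s) * Polynomial.X ^ 2) *
          (Polynomial.C (τ' ^ n) * (extPoly n).comp (Polynomial.C (Q ^ s) * Polynomial.X) -
            extPoly n) -
        (Polynomial.X ^ 2 - Polynomial.C (Q * Q ^ s)) *
          (Polynomial.C ((Q ^ s) ^ n) * (extPoly n).comp (Polynomial.C τ' * Polynomial.X) -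
            extPoly n) -
        Polynomial.C (Q * Q ^ s * ((Q ^ s) ^ n - 1) + (τ' ^ n - 1)) * (1 - Polynomial.X ^ 2) *
          extPoly n)

theorem eval_interpPoly (Q τ' : GroupAlg n) (s : ℕ) (z : GroupAlg n) :
    (interpPoly n Q τ' s).eval z =
    (τ' ^ n * (1 - Q ^ s)) * ((1 - z ^ 2) *
      ∑ i, z * (extPolyOmit i).eval z * nodeWeight Q s i) -
    weightPoly n Q s *
      ((1 - Q * Q ^ s * z ^ 2) *
          (τ' ^ n * (extPoly n).eval (Q ^ s * z) - (extPoly n).eval z) -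
        (z ^ 2 - Q * Q ^ s) *
          ((Q ^ s) ^ n * (extPoly n).eval (τ' * z) - (extPoly n).eval z) -
        (Q * Q ^ s * ((Q ^ s) ^ n - 1) + (τ' ^ n - 1)) * (1 - z ^ 2) *
          (extPoly n).eval z) := by
  simp only [interpPoly, Polynomial.eval_sub, Polynomial.eval_mul, Polynomial.eval_C,
    Polynomial.eval_one, Polynomial.eval_pow, Polynomial.eval_X,
    Polynomial.eval_finsetSum, Polynomial.eval_comp]

/-- This node determines the scalar in the last term of `interpPoly`: that term carries the factor
`(1 - z²) H(z)` and so vanishes at all the other nodes. -/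
theorem eval_interpPoly_zero (Q τ' : GroupAlg n) (s : ℕ) :
    (interpPoly n Q τ' s).eval 0 = 0 := by
  rw [eval_interpPoly]
  simp only [eval_extPoly, mul_zero, sub_zero, mul_one, prod_const_one, zero_mul, sum_const_zero,
    ne_eq, OfNat.ofNat_ne_zero, not_false_eq_true, zero_pow]
  ring

theorem eval_extPoly_reverse {a b : GroupAlg n} (hab : a * b = 1) :
    (extPoly n).eval a = (a ^ 2) ^ n * (extPoly n).eval b := by
  rw [eval_extPoly, eval_extPoly]
  have : (a ^ 2) ^ n = ∏ _j : Fin n, a ^ 2 := by simp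
  rw [this, ← prod_mul_distrib]
  exact prod_congr rfl fun j _ => factor_reverse j hab

theorem eval_extPolyOmit_reverse (i : Fin n) {a b : GroupAlg n} (hab : a * b = 1) :
    (extPolyOmit i).eval a = (a ^ 2) ^ (n - 1) * (extPolyOmit i).eval b := by
  rw [eval_extPolyOmit, eval_extPolyOmit]
  have : (a ^ 2) ^ (n - 1) = ∏ _j ∈ univ.erase i, a ^ 2 := by simp
  rw [this, ← prod_mul_distrib]
  exact prod_congr rfl fun j _ => factor_reverse j hab

/-- At `z = ±1` the terms with `1 - z²` drop out, and the reciprocity `H(a) = a^{2n} H(a⁻¹)` makes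
`τ⁻ⁿ H(τz)` and `τⁿ H(τ⁻¹z)` equal. -/
theorem eval_interpPoly_of_sq {Q τ' : GroupAlg n} {s : ℕ} (hτ : Q ^ s * τ' = 1) {z : GroupAlg n}
    (hz : z * z = 1) : (interpPoly n Q τ' s).eval z = 0 := by
  rw [eval_interpPoly]
  have h : (extPoly n).eval (Q ^ s * z) = ((Q ^ s) ^ n * (Q ^ s) ^ n) *
      (extPoly n).eval (τ' * z) := by
    rw [eval_extPoly_reverse (a := Q ^ s * z) (b := τ' * z) (by linear_combination z * z * hτ + hz),
      ← mul_pow]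
    congr 2
    linear_combination (Q ^ s) ^ 2 * hz
  have h2 : τ' ^ n * ((Q ^ s) ^ n * (Q ^ s) ^ n) = (Q ^ s) ^ n := by
    rw [← mul_pow, ← mul_pow]
    congr 1
    linear_combination Q ^ s * hτ
  have hz' : z ^ 2 = 1 := by rw [sq, hz]
  rw [hz', h, ← mul_assoc (τ' ^ n), h2]
  ring

/-- The pair `a`, `b` stands for `x_i`, `x_i⁻¹` in either order, with `B`, `B'` exchanged
accordingly, so that one argument serves both nodes. -/
theorem eval_interpPoly_node {Q τ' : GroupAlg n} {s : ℕ} (hτ : Q ^ s * τ' = 1) (i : Fin n)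
    {a b B B' : GroupAlg n} (hab : a * b = 1)
    (hH : extPoly n = ((1 - Polynomial.C a * Polynomial.X) *
      (1 - Polynomial.C b * Polynomial.X)) * extPolyOmit i)
    (hB : B * (((1 - a ^ 2) * (1 - Q * a ^ 2)) *
        ∏ j ∈ univ.erase i, ((1 - xVar j * a) * (1 - xInv j * a))) =
      weightPoly n Q s * (((1 - Q ^ s * a ^ 2) * (1 - Q ^ s * Q * a ^ 2)) *
        ∏ j ∈ univ.erase i, ((1 - Q ^ s * (xVar j * a)) * (1 - Q ^ s * (xInv j * a)))))
    (hB' : B' * (((1 - b ^ 2) * (1 - Q * b ^ 2)) *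
        ∏ j ∈ univ.erase i, ((1 - xVar j * b) * (1 - xInv j * b))) =
      weightPoly n Q s * (((1 - Q ^ s * b ^ 2) * (1 - Q ^ s * Q * b ^ 2)) *
        ∏ j ∈ univ.erase i, ((1 - Q ^ s * (xVar j * b)) * (1 - Q ^ s * (xInv j * b)))))
    (hK : nodeWeight Q s i = B * (b * (1 - Q * a ^ 2)) + B' * (a * (1 - Q * b ^ 2)))
    (hva : (1 - xVar i * a) * (1 - xInv i * a) = 0) :
    (interpPoly n Q τ' s).eval a = 0 := by
  obtain ⟨k, hk⟩ : ∃ k, n = k + 1 := ⟨n - 1, by have := i.2; omega⟩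
  have hHz : ∀ z, (extPoly n).eval z = ((1 - a * z) * (1 - b * z)) * (extPolyOmit i).eval z := by
    intro z
    rw [hH]; simp
  have hzero : (extPoly n).eval a = 0 := by
    rw [hHz, mul_comm b a, hab]; ring
  -- For `j ≠ i` the polynomial omitting `j` still contains the factor of index `i`, which vanishes
  -- at `a`.
  have hsum : ∑ j, a * (extPolyOmit j).eval a * nodeWeight Q s j =
      a * (extPolyOmit i).eval a * nodeWeight Q s i := by
    refine sum_eq_single i (fun j _ hj => ?_) (fun h => absurd (mem_univ i) h)
    have : (extPolyOmit j).eval a = 0 := by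
      rw [eval_extPolyOmit]
      exact prod_eq_zero (mem_erase.2 ⟨hj.symm, mem_univ i⟩) hva
    rw [this]; ring
  have hN : ∀ c : GroupAlg n, ∏ j ∈ univ.erase i,
      ((1 - Q ^ s * (xVar j * c)) * (1 - Q ^ s * (xInv j * c))) =
        (extPolyOmit i).eval (Q ^ s * c) := by
    intro c
    rw [eval_extPolyOmit]
    refine prod_congr rfl fun j _ => ?_
    ring
  rw [hN] at hB hB'
  rw [← eval_extPolyOmit] at hB hB'
  have hD := eval_extPolyOmit_reverse i hab
  have hk' : n - 1 = k := by omega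
  rw [hk'] at hD
  have main := node_identity k hab hτ hB hB' hD
  have e1 : (extPoly n).eval (Q ^ s * a) =
      (1 - Q ^ s) * (1 - Q ^ s * a ^ 2) * (extPolyOmit i).eval (Q ^ s * a) := by
    rw [hHz]
    linear_combination (-(Q ^ s) * (1 - Q ^ s * a ^ 2) * (extPolyOmit i).eval (Q ^ s * a)) * hab
  have hpow : (τ' ^ 2 * a ^ 2) ^ n = (τ' ^ 2 * a ^ 2) ^ (k + 1) := congrArg _ hk
  have e2 : (extPoly n).eval (τ' * a) = (τ' ^ 2 * a ^ 2) ^ (k + 1) *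
      ((1 - Q ^ s * b ^ 2) * (1 - Q ^ s) * (extPolyOmit i).eval (Q ^ s * b)) := by
    rw [eval_extPoly_reverse (a := τ' * a) (b := Q ^ s * b)
      (by linear_combination a * b * hτ + hab), hHz, mul_pow, hpow]
    linear_combination (-((τ' ^ 2 * a ^ 2) ^ (k + 1)) * Q ^ s * (1 - Q ^ s * b ^ 2) *
      (extPolyOmit i).eval (Q ^ s * b)) * hab
  rw [eval_interpPoly, hsum, hzero, hK, e1, e2]
  subst hk
  linear_combination main

theorem natDegree_sub_le_of_le_of_le {R : Type*} [Ring R] {p q : Polynomial R} {m : ℕ}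
    (hp : p.natDegree ≤ m) (hq : q.natDegree ≤ m) : (p - q).natDegree ≤ m :=
  (Polynomial.natDegree_sub_le p q).trans (max_le hp hq)

theorem natDegree_extPolyOmit_le (i : Fin n) : (extPolyOmit i).natDegree ≤ 2 * (n - 1) := by
  rw [extPolyOmit]
  refine (Polynomial.natDegree_prod_le _ _).trans ?_
  refine (sum_le_card_nsmul _ _ 2 fun j _ => ?_).trans ?_
  · compute_degree
  · simp [mul_comm]

theorem natDegree_extPoly_le : (extPoly n).natDegree ≤ 2 * n := by
  rw [extPoly]
  refine (Polynomial.natDegree_prod_le _ _).trans ?_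
  refine (sum_le_card_nsmul _ _ 2 fun j _ => ?_).trans ?_
  · compute_degree
  · simp [mul_comm]

theorem natDegree_interpPoly_le (Q τ' : GroupAlg n) (s : ℕ) :
    (interpPoly n Q τ' s).natDegree ≤ 2 * n + 2 := by
  have h1 : ∀ c : GroupAlg n,
      ((extPoly n).comp (Polynomial.C c * Polynomial.X)).natDegree ≤ 2 * n := by
    intro c
    refine Polynomial.natDegree_comp_le.trans ?_
    have : (Polynomial.C c * Polynomial.X : Polynomial (GroupAlg n)).natDegree ≤ 1 := by
      compute_degree
    calc _ ≤ (2 * n) * 1 := Nat.mul_le_mul natDegree_extPoly_le this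
      _ = 2 * n := mul_one _
  have h2 : ∀ c d : GroupAlg n, (Polynomial.C c * (extPoly n).comp
      (Polynomial.C d * Polynomial.X) - extPoly n).natDegree ≤ 2 * n := by
    intro c d
    refine natDegree_sub_le_of_le_of_le ?_ natDegree_extPoly_le
    exact (Polynomial.natDegree_C_mul_le _ _).trans (h1 d)
  rw [interpPoly]
  refine natDegree_sub_le_of_le_of_le ?_ ?_
  · refine (Polynomial.natDegree_C_mul_le _ _).trans ?_
    rcases Nat.eq_zero_or_pos n with rfl | hn
    · simp
    · have h3 : (∑ i, Polynomial.X * extPolyOmit i *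
          Polynomial.C (nodeWeight Q s i)).natDegree ≤ 2 * n - 1 := by
        refine Polynomial.natDegree_sum_le_of_forall_le _ _ fun i _ => ?_
        refine (Polynomial.natDegree_mul_C_le _ _).trans ?_
        refine (Polynomial.natDegree_mul_le_of_le Polynomial.natDegree_X_le
          (natDegree_extPolyOmit_le i)).trans ?_
        omega
      have h4 : (1 - Polynomial.X ^ 2 : Polynomial (GroupAlg n)).natDegree ≤ 2 := by compute_degree
      refine (Polynomial.natDegree_mul_le_of_le h4 h3).trans ?_
      omega
  · refine (Polynomial.natDegree_C_mul_le _ _).trans ?_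
    refine natDegree_sub_le_of_le_of_le (natDegree_sub_le_of_le_of_le ?_ ?_) ?_
    · have h4 : (1 - Polynomial.C (Q * Q ^ s) * Polynomial.X ^ 2 :
          Polynomial (GroupAlg n)).natDegree ≤ 2 := by compute_degree
      exact (Polynomial.natDegree_mul_le_of_le h4 (h2 _ _)).trans (by omega)
    · have h4 : (Polynomial.X ^ 2 - Polynomial.C (Q * Q ^ s) :
          Polynomial (GroupAlg n)).natDegree ≤ 2 := by compute_degree
      exact (Polynomial.natDegree_mul_le_of_le h4 (h2 _ _)).trans (by omega)
    · have h4 : (1 - Polynomial.X ^ 2 : Polynomial (GroupAlg n)).natDegree ≤ 2 := by compute_degree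
      exact (Polynomial.natDegree_mul_le_of_le ((Polynomial.natDegree_C_mul_le _ _).trans h4)
        natDegree_extPoly_le).trans (by omega)

/-- The interpolation nodes `x_i`, `x_i⁻¹`, `1`, `-1` and `0`. -/
def interpNode : (Fin n × ℤˣ) ⊕ Fin 3 → GroupAlg n :=
  Sum.elim (fun p => fexp (Pi.single p.1 (p.2 : ℤ))) ![1, -1, 0]

theorem interpNode_injective : Function.Injective (interpNode (n := n)) := by
  have hne0 : ∀ μ : Weight n, fexp μ ≠ 0 := fun μ h => by
    have := coeff_fexp μ μ
    rw [h] at this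
    simp at this
  have hneg : ∀ μ : Weight n, fexp μ ≠ -1 := fun μ h => by
    have h1 := congrArg (fun f : GroupAlg n => f.coeff μ) h
    have h2 : (-1 : GroupAlg n).coeff μ = -(fexp (0 : Weight n)).coeff μ := rfl
    simp only [h2, coeff_fexp, if_true] at h1
    split_ifs at h1 <;> norm_num at h1
  have hone : ∀ p : Fin n × ℤˣ, fexp (Pi.single p.1 (p.2 : ℤ)) ≠ 1 := fun p h => by
    have h1 := congrFun (fexp_injective (h.trans fexp_zero.symm)) p.1
    simp at h1
  have hinj : Function.Injective fun p : Fin n × ℤˣ => fexp (Pi.single p.1 (p.2 : ℤ)) := by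
    rintro ⟨i, a⟩ ⟨j, b⟩ h
    have h1 := fexp_injective h
    refine two_mul_single_injective ?_
    have h2 : ∀ (i : Fin n) (a : ℤ), (Pi.single i (2 * a) : Weight n) = 2 • Pi.single i a := by
      intro i a
      rw [two_mul, Pi.single_add, two_nsmul]
    change Pi.single i (2 * (a : ℤ)) = (Pi.single j (2 * (b : ℤ)) : Weight n)
    rw [h2, h2]
    exact congrArg (2 • ·) h1
  have h11 : (1 : GroupAlg n) ≠ -1 := fexp_zero (n := n) ▸ hneg 0
  have h10 : (1 : GroupAlg n) ≠ 0 := fexp_zero (n := n) ▸ hne0 0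
  have hm10 : (-1 : GroupAlg n) ≠ 0 := neg_ne_zero.2 h10
  refine hinj.sumElim ?_ ?_
  · intro a b h
    fin_cases a <;> fin_cases b <;> simp [h11, h11.symm] at h ⊢
  · intro p b
    fin_cases b
    · exact hone p
    · exact hneg _
    · exact hne0 _

/-- The interpolation formula. -/
theorem interpPoly_eq_zero {Q τ' : GroupAlg n} {s : ℕ} (hτ : Q ^ s * τ' = 1) :
    interpPoly n Q τ' s = 0 := by
  refine Polynomial.eq_zero_of_natDegree_lt_card_of_eval_eq_zero _ interpNode_injective ?_ ?_
  · rintro (⟨i, a⟩ | b)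
    · have hcomm := xVar_mul_xInv i
      rcases Int.units_eq_one_or a with rfl | rfl
      · refine eval_interpPoly_node hτ i hcomm (extPoly_eq_mul_omit i)
          (shiftedWeight_mul Q s i) (shiftedWeightInv_mul Q s i) rfl ?_
        change (1 - xVar i * xVar i) * (1 - xInv i * xVar i) = 0
        rw [mul_comm (xInv i), hcomm]; ring
      · refine eval_interpPoly_node (b := xVar i) hτ i ((mul_comm _ _).trans hcomm) ?_
          (shiftedWeightInv_mul Q s i) (shiftedWeight_mul Q s i) (add_comm _ _) ?_
        · rw [extPoly_eq_mul_omit i, mul_comm (1 - Polynomial.C (xVar i) * Polynomial.X)]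
          rfl
        · change (1 - xVar i * xInv i) * (1 - xInv i * xInv i) = 0
          rw [hcomm]; ring
    · fin_cases b
      · exact eval_interpPoly_of_sq hτ (one_mul 1)
      · exact eval_interpPoly_of_sq hτ (by simp [interpNode])
      · exact eval_interpPoly_zero Q τ' s
  -- There are `2n + 3` nodes against degree at most `2n + 2`.
  · refine lt_of_le_of_lt (natDegree_interpPoly_le Q τ' s) ?_
    simp
    omega

/-- The two-term recurrence for the constant terms against the coefficients of `extPoly`. -/
theorem constTerm_recurrence (q : ℂˣ) (hq : (q : ℂ) ≠ 1) (s r d : ℕ) (hn : n = r + 2 + d) :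
    constTerm (weightPoly n (algebraMap ℂ _ (q : ℂ)) s * (extPoly n).coeff (r + 2)) *
        ((((q : ℂ) ^ s) ^ (r + 2) - 1) * (1 - q * ((q : ℂ) ^ s) ^ (r + 3 + 2 * d))) =
      constTerm (weightPoly n (algebraMap ℂ _ (q : ℂ)) s * (extPoly n).coeff r) *
        ((((q : ℂ) ^ s) ^ (r + 4 + 2 * d) - 1) * (1 - q * ((q : ℂ) ^ s) ^ (r + 1))) := by
  set t : ℂ := (q : ℂ) ^ s with ht
  have ht0 : t ≠ 0 := pow_ne_zero _ (Units.ne_zero q)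
  have hQ : (algebraMap ℂ (GroupAlg n) (q : ℂ)) ^ s = algebraMap ℂ (GroupAlg n) t := by
    rw [← map_pow]
  have hτ : (algebraMap ℂ (GroupAlg n) (q : ℂ)) ^ s * algebraMap ℂ (GroupAlg n) t⁻¹ = 1 := by
    rw [hQ, ← map_mul, mul_inv_cancel₀ ht0, map_one]
  have h := congrArg (fun p => constTerm (p.coeff (r + 2))) (interpPoly_eq_zero hτ)
  simp only [Polynomial.coeff_zero, map_zero] at h
  set W := weightPoly n (algebraMap ℂ _ (q : ℂ)) s with hW
  set G := ∑ i, Polynomial.X * extPolyOmit i *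
    Polynomial.C (nodeWeight (algebraMap ℂ (GroupAlg n) (q : ℂ)) s i) with hG
  -- The whole interpolation sum disappears under the constant term; what remains is a relation
  -- between `g_{r+2}` and `g_r` alone.
  have hG0 : ∀ m, constTerm (G.coeff m) = 0 := by
    intro m
    rw [hG, Polynomial.finsetSum_coeff, map_sum]
    exact sum_eq_zero fun i _ => constTerm_coeff_omit q hq s i m
  rw [interpPoly, ← hG, ← hW, hQ] at h
  have hX' : ∀ p : Polynomial (GroupAlg n), (Polynomial.X ^ 2 * p).coeff (r + 2) = p.coeff r :=
    fun p => Polynomial.coeff_X_pow_mul p 2 r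
  have e : ∀ c : ℂ, ∀ f, constTerm (W * (algebraMap ℂ (GroupAlg n) c * f)) =
      c * constTerm (W * f) := by
    intro c f
    rw [mul_left_comm, constTerm_algebraMap_mul]
  have hcoef : ∀ c : ℂ, ∀ m, ((extPoly n).comp
      (Polynomial.C (algebraMap ℂ (GroupAlg n) c) * Polynomial.X)).coeff m =
      algebraMap ℂ (GroupAlg n) (c ^ m) * (extPoly n).coeff m := by
    intro c m
    rw [Polynomial.comp_C_mul_X_coeff, map_pow, mul_comm]
  simp only [sub_mul, one_mul, mul_assoc, Polynomial.coeff_sub, Polynomial.coeff_C_mul, hX',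
    hcoef, mul_sub, map_sub] at h
  simp only [← map_pow, ← map_mul, ← map_one (algebraMap ℂ (GroupAlg n)), ← map_sub, ← map_add,
    e, constTerm_algebraMap_mul, hG0] at h
  generalize constTerm (W * (extPoly n).coeff (r + 2)) = g₂ at h ⊢
  generalize constTerm (W * (extPoly n).coeff r) = g₀ at h ⊢
  -- All exponents are rewritten through `t^r` and `t^d`, so that the negative powers of `t` can be
  -- cleared by field arithmetic.
  have hn' : t ^ n = t ^ r * t ^ 2 * t ^ d := by rw [hn, pow_add, pow_add]
  have e1 : t ^ (r + 3 + 2 * d) = t ^ r * t ^ 3 * (t ^ d) ^ 2 := by ring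
  have e2 : t ^ (r + 4 + 2 * d) = t ^ r * t ^ 4 * (t ^ d) ^ 2 := by ring
  have e3 : t ^ (r + 1) = t ^ r * t := by ring
  have e4 : t ^ (r + 2) = t ^ r * t ^ 2 := by ring
  have hr0 : t ^ r ≠ 0 := pow_ne_zero _ ht0
  have hd0 : t ^ d ≠ 0 := pow_ne_zero _ ht0
  simp only [inv_pow, hn', e4] at h
  rw [e1, e2, e3, e4]
  generalize t ^ r = R at h hr0 ⊢
  generalize t ^ d = D at h hd0 ⊢
  field_simp at h
  linear_combination -h

/-! ### Multiplicities of the fundamental characters at `t = q^(k+1)` -/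

/-- The Macdonald kernel at `t = Q^{k+1}`. -/
def kernelPoly (n : ℕ) (Q : GroupAlg n) (k : ℕ) : GroupAlg n :=
  (∏ m ∈ range k, (1 - Q ^ (m + 1))) ^ n *
    ∏ α ∈ roots n, ∏ m ∈ range k, (1 - Q ^ (m + 1) * fexp α)

theorem isSymm_kernelPoly (q : ℂ) (k : ℕ) :
    IsSymm (kernelPoly n (algebraMap ℂ _ q) k) := by
  intro w
  rw [kernelPoly, map_mul, map_pow, map_prod, map_prod]
  congr 1
  · congr 1
    refine prod_congr rfl fun m _ => ?_
    rw [map_sub, map_one, map_pow, AlgHom.commutes]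
  · rw [← w.prod_roots_act fun α => ∏ m ∈ range k, (1 - algebraMap ℂ _ q ^ (m + 1) * fexp α)]
    refine prod_congr rfl fun α _ => ?_
    rw [map_prod]
    refine prod_congr rfl fun m _ => ?_
    rw [map_sub, map_one, map_mul, map_pow, AlgHom.commutes, Weyl.actAlg_fexp]

theorem prod_mul_weightPoly (Q : GroupAlg n) (k : ℕ) :
    (∏ m ∈ range k, (1 - Q ^ (m + 1))) ^ n * weightPoly n Q (k + 1) =
      (-1) ^ n * (kernelPoly n Q k * alternant (rho n) ^ 2) := by
  have h : weightPoly n Q (k + 1) = (∏ α ∈ roots n, ∏ m ∈ range k, (1 - Q ^ (m + 1) * fexp α)) *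
      ∏ α ∈ roots n, (1 - fexp α) := by
    rw [weightPoly, ← prod_mul_distrib]
    refine prod_congr rfl fun α _ => ?_
    rw [prod_range_succ', pow_zero, one_mul]
  rw [h, prod_one_sub_fexp_roots, kernelPoly]
  ring

theorem constTerm_mul_fexp (f : GroupAlg n) (μ : Weight n) :
    constTerm (f * fexp μ) = f.coeff (-μ) := by
  change (f * fexp μ).coeff 0 = _
  rw [fexp, AddMonoidAlgebra.coeff_mul_single_apply, zero_add, mul_one]

/-- The constant term of `f e^{wμ}` is the coefficient of `f` at `-wμ`. Since `-1` is a Weyl group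
element of sign `(-1)^n`, antisymmetry makes all `|W|` signed contributions equal. -/
theorem IsAntisymm.constTerm_mul_alternant {f : GroupAlg n} (hf : IsAntisymm f) (μ : Weight n) :
    constTerm (f * alternant μ) = (-1) ^ n * Fintype.card (Weyl n) * f.coeff μ := by
  have h : ∀ w : Weyl n, constTerm (f * (((w.sgn : ℤˣ) : ℤ) • fexp (w.act μ))) =
      (-1) ^ n * f.coeff μ := by
    intro w
    have e : -w.act μ = (w.comp (1, -1)).act μ := by
      rw [Weyl.act_comp]; ext j; simp [Weyl.act]
    have hs : ((w.comp (1, -1)).sgn : ℤˣ) = (-1) ^ n * w.sgn := by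
      rw [Weyl.sgn_comp]; simp [Weyl.sgn]
    have h2 : (((w.sgn : ℤˣ) : ℤ) : ℂ) * ((w.sgn : ℤ) : ℂ) = 1 := by
      exact_mod_cast w.sgn_mul_self
    rw [mul_smul_comm, map_zsmul, constTerm_mul_fexp, e, hf.coeff_act, hs, zsmul_eq_mul]
    push_cast
    linear_combination (-1) ^ n * f.coeff μ * h2
  rw [alternant, mul_sum, map_sum, sum_congr rfl fun w _ => h w, sum_const, card_univ]
  simp only [nsmul_eq_mul]
  ring

theorem IsSymm.constTerm_mul_alternant {f : GroupAlg n} (hf : IsSymm f) (μ : Weight n) :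
    constTerm ((-1) ^ n * (f * (alternant (rho n) * alternant (μ + rho n)))) =
      Fintype.card (Weyl n) * multiplicity μ f := by
  have h := (hf.mul_isAntisymm (alternant_isAntisymm (rho n))).constTerm_mul_alternant (μ + rho n)
  have e : ((-1) ^ n : GroupAlg n) = algebraMap ℂ _ ((-1) ^ n) := by
    rw [map_pow, map_neg, map_one]
  rw [← mul_assoc f, e, constTerm_algebraMap_mul, h]
  have h2 : ((-1 : ℂ) ^ n) * (-1) ^ n = 1 := by rw [← mul_pow]; simp
  change (-1) ^ n * ((-1) ^ n * _ * multiplicity μ f) = _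
  linear_combination (Fintype.card (Weyl n) : ℂ) * multiplicity μ f * h2

/-- The recurrence for the multiplicities of the fundamental characters at `t = q^(k+1)`. -/
theorem multiplicity_recurrence (q : ℂ) (hq0 : q ≠ 0) (hq1 : q ≠ 1) (s j e : ℕ)
    (hn : n = 2 * j + 2 + e) (t : ℂ) (ht : t = q ^ (s + 1)) :
    multiplicity (fundamentalWeight n (2 * (j + 1))).1 (kernelPoly n (algebraMap ℂ _ q) s) *
        ((t ^ (2 * e + 6) - 1) * (t ^ (2 * j + 2) - 1) * (1 - q * t ^ (2 * e + 2 * j + 3))) =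
      multiplicity (fundamentalWeight n (2 * j)).1 (kernelPoly n (algebraMap ℂ _ q) s) *
        ((t ^ (2 * e + 2) - 1) * (t ^ (2 * e + 2 * j + 6) - 1) * (t - q * t ^ (2 * j)) * t) := by
  set c : ℂ := (∏ m ∈ range s, (1 - q ^ (m + 1))) ^ n with hc
  set P := kernelPoly n (algebraMap ℂ _ q) s with hP
  have hPs : IsSymm P := isSymm_kernelPoly q s
  set δ : ℕ → ℂ := fun r =>
    c * constTerm (weightPoly n (algebraMap ℂ _ q) (s + 1) * (extPoly n).coeff r) with hδ
  have hδ' : ∀ r, δ r = constTerm ((-1) ^ n *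
      (P * (alternant (rho n) * ((extPoly n).coeff r * alternant (rho n))))) := by
    intro r
    have h := prod_mul_weightPoly (n := n) (algebraMap ℂ _ q) s
    have h1 : (∏ m ∈ range s, (1 - (algebraMap ℂ (GroupAlg n) q) ^ (m + 1))) ^ n =
        algebraMap ℂ _ c := by
      rw [hc, map_pow, map_prod]
      simp only [map_sub, map_one, map_pow]
    rw [h1] at h
    simp only [hδ]
    rw [← constTerm_algebraMap_mul, ← mul_assoc, h]
    congr 1
    ring
  have hrec : ∀ r d, n = r + 2 + d → δ (r + 2) *
      ((t ^ (r + 2) - 1) * (1 - q * t ^ (r + 3 + 2 * d))) =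
      δ r * ((t ^ (r + 4 + 2 * d) - 1) * (1 - q * t ^ (r + 1))) := by
    intro r d hr
    have h := constTerm_recurrence (n := n) (Units.mk0 q hq0) hq1 (s + 1) r d hr
    simp only [Units.val_mk0, ← ht] at h
    simp only [hδ]
    linear_combination c * h
  have hcard : (Fintype.card (Weyl n) : ℂ) ≠ 0 := by
    exact_mod_cast Fintype.card_ne_zero
  have hsucc : ∀ i, 2 * i + 2 ≤ n → Fintype.card (Weyl n) *
      multiplicity (fundamentalWeight n (2 * (i + 1))).1 P = δ (2 * i + 2) - δ (2 * i) := by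
    intro i hi
    have h := coeff_extPoly_sub_mul_alternant (2 * i) hi
    rw [pow_mul, neg_one_sq, one_pow, one_mul] at h
    have e2 : 2 * (i + 1) = 2 * i + 2 := by ring
    rw [← hPs.constTerm_mul_alternant, e2, ← h, hδ', hδ', ← map_sub]
    congr 1
    ring
  have hzero : Fintype.card (Weyl n) * multiplicity (fundamentalWeight n 0).1 P = δ 0 := by
    have e2 : (fundamentalWeight n 0).1 + rho n = rho n := by
      ext i; simp [fundamentalWeight]
    rw [← hPs.constTerm_mul_alternant, e2, hδ', coeff_zero_extPoly, one_mul]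
  apply mul_left_cancel₀ hcard
  have h1 := hsucc j (by omega)
  have r1 := hrec (2 * j) e hn
  have hA : (t ^ (2 * e + 6) - 1) * (t ^ (2 * j + 2) - 1) * (1 - q * t ^ (2 * e + 2 * j + 3)) =
      (t ^ (2 * e + 6) - 1) * ((t ^ (2 * j + 2) - 1) * (1 - q * t ^ (2 * j + 3 + 2 * e))) := by
    ring
  rw [← mul_assoc, ← mul_assoc (Fintype.card (Weyl n) : ℂ), h1]
  -- For `j = 0` there is no `δ (2j - 2)`: the trivial character is `H_0 = 1` itself, not a
  -- difference.
  cases j with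
  | zero =>
    have h0 : Fintype.card (Weyl n) * multiplicity (fundamentalWeight n (2 * 0)).1 P = δ 0 := hzero
    rw [h0]
    rw [mul_zero] at r1 hA ⊢
    linear_combination (δ (0 + 2) - δ 0) * hA + (t ^ (2 * e + 6) - 1) * r1
  | succ i =>
    rw [hsucc i (by omega)]
    -- With `j = i + 1`, the relations `r1` and `r2` express `δ (2j + 2)` and `δ (2j - 2)` through
    -- `δ (2j)`. In the two differences the numerators factor as `(t - q) t^{2j+1} (t^{2e+2} - 1)`
    -- and `(t - q) t^{2j-1} (t^{2e+6} - 1)`, which is where these factors of the claim originate.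
    -- The combination below performs the elimination without division.
    have r2 := hrec (2 * i) (e + 2) (by omega)
    have e2 : 2 * (i + 1) = 2 * i + 2 := by ring
    rw [e2] at r1 hA ⊢
    linear_combination (δ (2 * i + 2 + 2) - δ (2 * i + 2)) * hA +
      (t ^ (2 * e + 6) - 1) * r1 - (t ^ (2 * e + 2) - 1) * t ^ 2 * r2

/-! ### The specialization `t = q^s` -/

/-- The exponent `s + 1` keeps the constant term zero for every `s`, as substitution into a power
series requires. -/
theorem hasSubst_specialize (R : Type) [CommRing R] (s : ℕ) :
    MvPowerSeries.HasSubst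
      (![PowerSeries.X, PowerSeries.X ^ (s + 1)] : Fin 2 → MvPowerSeries Unit R) := by
  refine MvPowerSeries.hasSubst_of_constantCoeff_zero fun i => ?_
  fin_cases i
  · exact PowerSeries.constantCoeff_X
  · change PowerSeries.constantCoeff (PowerSeries.X ^ (s + 1)) = 0
    simp

/-- The substitution `t = q^{s+1}`. -/
def specialize (R : Type) [CommRing R] (s : ℕ) : QT R →ₐ[R] PowerSeries R :=
  MvPowerSeries.substAlgHom (hasSubst_specialize R s)

theorem specialize_qVar (R : Type) [CommRing R] (s : ℕ) :
    specialize R s (qVar R) = PowerSeries.X :=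
  MvPowerSeries.substAlgHom_X (hasSubst_specialize R s) 0

theorem specialize_tVar (R : Type) [CommRing R] (s : ℕ) :
    specialize R s (tVar R) = PowerSeries.X ^ (s + 1) :=
  MvPowerSeries.substAlgHom_X (hasSubst_specialize R s) 1

theorem specialize_C (R : Type) [CommRing R] (s : ℕ) (r : R) :
    specialize R s (MvPowerSeries.C r) = PowerSeries.C r :=
  (specialize R s).commutes r

theorem coeff_specialize_aux (R : Type) [CommRing R] (s : ℕ) (f : QT R) (e : ℕ) :
    (Function.support fun d : Fin 2 →₀ ℕ =>
        if e = d 0 + (s + 1) * d 1 then MvPowerSeries.coeff d f else 0).Finite ∧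
    PowerSeries.coeff e (specialize R s f) = ∑ᶠ d : Fin 2 →₀ ℕ,
        if e = d 0 + (s + 1) * d 1 then MvPowerSeries.coeff d f else 0 := by
  have key : ∀ d : Fin 2 →₀ ℕ, MvPowerSeries.coeff d f • PowerSeries.coeff e (d.prod fun i k =>
      (![PowerSeries.X, PowerSeries.X ^ (s + 1)] : Fin 2 → PowerSeries R) i ^ k) =
      if e = d 0 + (s + 1) * d 1 then MvPowerSeries.coeff d f else 0 := by
    intro d
    rw [Finsupp.prod_fintype _ _ (by simp), Fin.prod_univ_two]
    simp only [Matrix.cons_val_zero, Matrix.cons_val_one]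
    rw [← pow_mul, ← pow_add, PowerSeries.coeff_X_pow]
    simp
  have h1 := MvPowerSeries.coeff_subst_finite (hasSubst_specialize R s) f (Finsupp.single () e)
  have h2 := MvPowerSeries.coeff_subst (hasSubst_specialize R s) f (Finsupp.single () e)
  constructor
  · rw [← funext key]
    exact h1
  · rw [specialize, MvPowerSeries.substAlgHom_apply]
    exact h2.trans (finsum_congr key)

/-- After the substitution each coefficient is a finite sum of coefficients of `f`, so the linear
functional `multiplicity μ` passes through it. -/
theorem coeff_specialize_multiplicitySeries (s : ℕ) (μ : Weight n) (f : QT (GroupAlg n)) (e : ℕ) :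
    PowerSeries.coeff e (specialize ℂ s (multiplicitySeries μ f)) =
      multiplicity μ (PowerSeries.coeff e (specialize (GroupAlg n) s f)) := by
  rw [(coeff_specialize_aux _ s _ e).2, (coeff_specialize_aux _ s _ e).2]
  have h := (multiplicity μ).toAddMonoidHom.map_finsum (coeff_specialize_aux _ s f e).1
  refine Eq.trans ?_ h.symm
  refine finsum_congr fun d => ?_
  split_ifs
  · rfl
  · exact (map_zero (multiplicity μ)).symm

theorem eq_zero_of_specialize_eq_zero {g : QT ℂ} (h : ∀ s, specialize ℂ s g = 0) : g = 0 := by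
  classical
  by_contra hg
  have hex : ∃ b a : ℕ, ∃ d : Fin 2 →₀ ℕ, d 0 = a ∧ d 1 = b ∧ MvPowerSeries.coeff d g ≠ 0 := by
    by_contra hc
    refine hg (MvPowerSeries.ext fun d => ?_)
    by_contra hd
    exact hc ⟨d 1, d 0, d, rfl, rfl, hd⟩
  have hb := fun m => Nat.find_min (m := m) hex
  obtain ⟨a, d, hda, hdb, hd⟩ := Nat.find_spec hex
  set b := Nat.find hex
  -- Here `b` is the least `t`-degree occurring in `g`, and `q^a t^b` occurs. Under `t = q^{a+1}`, a
  -- term of `t`-degree at least `b + 1` has degree at least `(a + 1)(b + 1) > a + (a + 1) b`, so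
  -- this coefficient of the image receives only `q^a t^b`.
  have hzero := congrArg (PowerSeries.coeff (a + (a + 1) * b)) (h a)
  rw [(coeff_specialize_aux ℂ a g _).2, finsum_eq_single _ d, if_pos (by rw [hda, hdb])] at hzero
  · exact hd (by simpa using hzero)
  · intro d' hd'
    split_ifs with he
    · by_contra hne
      have h1 : ¬ d' 1 < b := fun hlt => hb _ hlt ⟨d' 0, d', rfl, rfl, hne⟩
      have h2 : d' 1 = b := by
        by_contra hne'
        have h3 : b + 1 ≤ d' 1 := by omega
        have h4 := Nat.mul_le_mul_left (a + 1) h3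
        rw [mul_add] at h4
        omega
      rw [h2] at he
      refine hd' (Finsupp.ext fun i => ?_)
      fin_cases i
      · change d' 0 = d 0
        omega
      · change d' 1 = d 1
        omega
    · rfl

/-- The Macdonald kernel at `t = q^{k+1}` as a polynomial in `q`. -/
def kernelPolyX (n k : ℕ) : Polynomial (GroupAlg n) :=
  (∏ m ∈ range k, (1 - Polynomial.X ^ (m + 1))) ^ n *
    ∏ α ∈ roots n, ∏ m ∈ range k, (1 - Polynomial.X ^ (m + 1) * Polynomial.C (fexp α))

theorem eval_kernelPolyX (Q : GroupAlg n) (k : ℕ) :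
    (kernelPolyX n k).eval Q = kernelPoly n Q k := by
  simp only [kernelPolyX, kernelPoly, Polynomial.eval_mul, Polynomial.eval_pow,
    Polynomial.eval_prod, Polynomial.eval_sub, Polynomial.eval_one, Polynomial.eval_X,
    Polynomial.eval_C]

/-- At `t = q^{k+1}` the product of the quotients `(1 - q^{i+1} e^γ) / (1 - q^{k+1+i} e^γ)`
telescopes to its first `k` numerators, up to a tail that is trivial modulo `q^N`. -/
theorem specialize_prod_kernelTerm (k N : ℕ) (γ : Weight n) :
    specialize (GroupAlg n) k (∏ i ∈ range N, kernelTerm i γ) *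
        ∏ i ∈ range k, (1 - PowerSeries.X ^ (N + i + 1) * PowerSeries.C (fexp γ)) =
      ∏ i ∈ range k, (1 - PowerSeries.X ^ (i + 1) * PowerSeries.C (fexp γ)) := by
  set u : ℕ → PowerSeries (GroupAlg n) := fun j =>
    1 - PowerSeries.X ^ (j + 1) * PowerSeries.C (fexp γ) with hu
  have h1 : specialize (GroupAlg n) k (∏ i ∈ range N, kernelTerm i γ) *
      ∏ i ∈ range N, u (k + i) = ∏ i ∈ range N, u i := by
    rw [map_prod, ← prod_mul_distrib]
    refine prod_congr rfl fun i _ => ?_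
    have h := congrArg (specialize (GroupAlg n) k) (kernelTerm_mul i γ)
    simp only [map_mul, map_sub, map_one, map_pow, specialize_tVar, specialize_qVar,
      specialize_C] at h
    rw [← pow_add, show k + 1 + i = k + i + 1 by omega] at h
    exact h
  have h2 : (∏ i ∈ range N, u i) * ∏ i ∈ range k, u (N + i) =
      (∏ i ∈ range k, u i) * ∏ i ∈ range N, u (k + i) := by
    rw [← prod_range_add, ← prod_range_add, add_comm]
  have hunit : IsUnit (∏ i ∈ range N, u (k + i)) := by
    rw [PowerSeries.isUnit_iff_constantCoeff, map_prod]
    simp [hu]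
  apply hunit.mul_right_cancel
  linear_combination (∏ i ∈ range k, u (N + i)) * h1 + h2

theorem specialize_macdonaldKernel (k : ℕ) :
    specialize (GroupAlg n) k (macdonaldKernel n) = (kernelPolyX n k : PowerSeries (GroupAlg n)) := by
  rw [← sub_eq_zero]
  refine PowerSeries.ext fun e => ?_
  rw [map_zero]
  set N := e + 1 with hN
  refine PowerSeries.X_pow_dvd_iff.1 (?_ : (PowerSeries.X : PowerSeries (GroupAlg n)) ^ N ∣ _) e (by omega)
  have h1 : (PowerSeries.X : PowerSeries (GroupAlg n)) ^ N ∣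
      specialize (GroupAlg n) k (macdonaldKernel n) -
        specialize (GroupAlg n) k (∏ i ∈ range N, kernelFactor n i) := by
    rw [← map_sub, ← specialize_qVar (GroupAlg n) k, ← map_pow]
    refine map_dvd _ (MvPowerSeries.X_pow_dvd_iff.2 fun m hm => ?_)
    rw [map_sub, coeff_prod_kernelFactor n m N (by omega), sub_self]
  let I := Ideal.span {(PowerSeries.X : PowerSeries (GroupAlg n)) ^ N}
  have hterm : ∀ γ : Weight n, Ideal.Quotient.mk I
      (specialize (GroupAlg n) k (∏ i ∈ range N, kernelTerm i γ)) =
      Ideal.Quotient.mk I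
        (∏ i ∈ range k, (1 - PowerSeries.X ^ (i + 1) * PowerSeries.C (fexp γ))) := by
    intro γ
    have hX : Ideal.Quotient.mk I (PowerSeries.X ^ N) = 0 :=
      Ideal.Quotient.eq_zero_iff_mem.2 (Ideal.subset_span rfl)
    have h := congrArg (Ideal.Quotient.mk I) (specialize_prod_kernelTerm k N γ)
    rw [← h, map_mul]
    simp only [map_prod, map_sub, map_one, add_assoc, pow_add PowerSeries.X N, map_mul, hX,
      zero_mul, sub_zero, prod_const_one, mul_one]
  have h2 : Ideal.Quotient.mk I (specialize (GroupAlg n) k (∏ i ∈ range N, kernelFactor n i)) =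
      Ideal.Quotient.mk I (kernelPolyX n k : PowerSeries (GroupAlg n)) := by
    have e1 : (∏ i ∈ range N, kernelFactor n i) =
        (∏ i ∈ range N, kernelTerm i (0 : Weight n)) ^ n *
          ∏ α ∈ roots n, ∏ i ∈ range N, kernelTerm i α := by
      simp only [kernelFactor]
      rw [prod_mul_distrib, prod_pow, prod_comm]
    have e2 : (kernelPolyX n k : PowerSeries (GroupAlg n)) =
        (∏ i ∈ range k, (1 - PowerSeries.X ^ (i + 1) * PowerSeries.C (fexp (0 : Weight n)))) ^ n *
        ∏ α ∈ roots n, ∏ i ∈ range k, (1 - PowerSeries.X ^ (i + 1) * PowerSeries.C (fexp α)) := by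
      have hφ : ∀ p : Polynomial (GroupAlg n), (p : PowerSeries (GroupAlg n)) =
        Polynomial.coeToPowerSeries.ringHom p := fun p => rfl
      rw [hφ, kernelPolyX]
      simp only [map_mul, map_pow, map_prod, map_sub, map_one,
        Polynomial.coeToPowerSeries.ringHom_apply, Polynomial.coe_X, Polynomial.coe_C,
        fexp_zero, mul_one]
    rw [e1, e2]
    simp only [map_mul, map_pow, map_prod (specialize (GroupAlg n) k) _ (roots n)]
    rw [hterm, map_prod (Ideal.Quotient.mk I) _ (roots n), map_prod (Ideal.Quotient.mk I) _ (roots n),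
      prod_congr rfl fun α _ => hterm α]
  have h3 := Ideal.mem_span_singleton.1 (Ideal.Quotient.eq.1 h2)
  have := dvd_add h1 h3
  rwa [sub_add_sub_cancel] at this

/-- The multiplicity of the character of highest weight `μ` at `t = q^{k+1}`, as a polynomial. -/
def multiplicityPoly (n k : ℕ) (μ : Weight n) : Polynomial ℂ :=
  ∑ e ∈ range ((kernelPolyX n k).natDegree + 1),
    Polynomial.C (multiplicity μ ((kernelPolyX n k).coeff e)) * Polynomial.X ^ e

theorem coeff_multiplicityPoly (k : ℕ) (μ : Weight n) (e : ℕ) :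
    (multiplicityPoly n k μ).coeff e = multiplicity μ ((kernelPolyX n k).coeff e) := by
  rw [multiplicityPoly, Polynomial.finsetSum_coeff]
  simp only [Polynomial.coeff_C_mul_X_pow]
  rw [sum_ite_eq]
  split_ifs with h
  · rfl
  · rw [Polynomial.coeff_eq_zero_of_natDegree_lt, map_zero]
    rw [mem_range] at h
    omega

theorem eval_multiplicityPoly (k : ℕ) (μ : Weight n) (z : ℂ) :
    (multiplicityPoly n k μ).eval z = multiplicity μ (kernelPoly n (algebraMap ℂ _ z) k) := by
  rw [← eval_kernelPolyX, Polynomial.eval_eq_sum_range (p := kernelPolyX n k), map_sum, multiplicityPoly,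
    Polynomial.eval_finsetSum]
  refine sum_congr rfl fun e _ => ?_
  have h : (kernelPolyX n k).coeff e * algebraMap ℂ (GroupAlg n) z ^ e =
      z ^ e • (kernelPolyX n k).coeff e := by
    rw [← map_pow, mul_comm, ← Algebra.smul_def]
  rw [h, map_smul, Polynomial.eval_mul, Polynomial.eval_C, Polynomial.eval_pow, Polynomial.eval_X,
    smul_eq_mul, mul_comm]

theorem specialize_multiplicitySeries (k : ℕ) (μ : Weight n) :
    specialize ℂ k (multiplicitySeries μ (macdonaldKernel n)) =
      (multiplicityPoly n k μ : PowerSeries ℂ) := by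
  ext e
  rw [coeff_specialize_multiplicitySeries, specialize_macdonaldKernel, Polynomial.coeff_coe,
    Polynomial.coeff_coe, coeff_multiplicityPoly]

/-- The recurrence for the coefficients of the fundamental characters, with the denominators
cleared. -/
theorem multiplicitySeries_recurrence (j e : ℕ) (hn : n = 2 * j + 2 + e) :
    multiplicitySeries (fundamentalWeight n (2 * (j + 1))).1 (macdonaldKernel n) *
        ((tVar ℂ ^ (2 * e + 6) - 1) * (tVar ℂ ^ (2 * j + 2) - 1) *
          (1 - qVar ℂ * tVar ℂ ^ (2 * e + 2 * j + 3))) =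
      multiplicitySeries (fundamentalWeight n (2 * j)).1 (macdonaldKernel n) *
        ((tVar ℂ ^ (2 * e + 2) - 1) * (tVar ℂ ^ (2 * e + 2 * j + 6) - 1) *
          (tVar ℂ - qVar ℂ * tVar ℂ ^ (2 * j)) * tVar ℂ) := by
  rw [← sub_eq_zero]
  refine eq_zero_of_specialize_eq_zero fun s => ?_
  simp only [map_sub, map_mul, map_pow, map_one, specialize_tVar, specialize_qVar,
    specialize_multiplicitySeries, ← Polynomial.coe_X, ← Polynomial.coe_one, ← Polynomial.coe_pow,
    ← Polynomial.coe_mul, ← Polynomial.coe_sub]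
  rw [Polynomial.coe_eq_zero_iff]
  refine Polynomial.eq_zero_of_infinite_isRoot _ ?_
  -- The shift `x_i ↦ q x_i` needs `q` invertible, and the factor `q - 1` was cancelled; infinitely
  -- many values of `q` remain.
  refine Set.Infinite.mono (s := {0, 1}ᶜ) ?_ (Set.Finite.infinite_compl (by simp))
  intro z hz
  simp only [Set.mem_compl_iff, Set.mem_insert_iff, Set.mem_singleton_iff, not_or] at hz
  change Polynomial.eval z _ = 0
  simp only [Polynomial.eval_sub, Polynomial.eval_mul, Polynomial.eval_pow, Polynomial.eval_X,
    Polynomial.eval_one, eval_multiplicityPoly]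
  rw [sub_eq_zero]
  exact multiplicity_recurrence z hz.1 hz.2 s j e hn _ rfl

/-! ### The recurrence in the field of fractions -/

theorem toField_ne_zero {f : QT ℂ} (hf : MvPowerSeries.constantCoeff f ≠ 0) : toField f ≠ 0 := by
  intro h
  rw [toField, FaithfulSMul.algebraMap_eq_zero_iff] at h
  exact hf (by rw [h, map_zero])

theorem tt_ne_zero : tt ≠ 0 := by
  intro h
  rw [tt, toField, FaithfulSMul.algebraMap_eq_zero_iff] at h
  have := congrArg (MvPowerSeries.coeff (Finsupp.single 1 1)) h
  simp [tVar, MvPowerSeries.coeff_X] at this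

theorem tt_zpow_sub_one_ne_zero {m : ℤ} (hm : 0 < m) : tt ^ m - 1 ≠ 0 := by
  obtain ⟨k, rfl⟩ := Int.eq_ofNat_of_zero_le hm.le
  have hk : k ≠ 0 := by omega
  have h := toField_ne_zero (f := tVar ℂ ^ k - 1) (by simp [tVar, hk])
  simpa [toField, tt] using h

theorem one_sub_qq_mul_tt_zpow_ne_zero {m : ℤ} (hm : 0 < m) : 1 - qq * tt ^ m ≠ 0 := by
  obtain ⟨k, rfl⟩ := Int.eq_ofNat_of_zero_le hm.le
  have h := toField_ne_zero (f := 1 - qVar ℂ * tVar ℂ ^ k) (by simp [qVar])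
  simpa [toField, tt, qq] using h

theorem IsKernelExpansion.coeffC_succ {C : DominantWeight n → QT ℂ} (hC : IsKernelExpansion n C)
    (k : ℕ) (hk : 2 * (k + 1) ≤ n) :
    coeffC n C (k + 1) =
      ((tt ^ (2 * ((n : ℤ) - 2 * k - 1)) - 1) * (tt ^ (2 * ((n : ℤ) - k + 1)) - 1) *
          (1 - qq * tt ^ (2 * (k : ℤ) - 1)) * tt ^ 2) /
        ((tt ^ (2 * ((n : ℤ) - 2 * k + 1)) - 1) * (tt ^ (2 * ((k : ℤ) + 1)) - 1) *
          (1 - qq * tt ^ (2 * ((n : ℤ) - k) - 1))) * coeffC n C k := by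
  obtain ⟨e, he⟩ := Nat.exists_eq_add_of_le hk
  have hn : n = 2 * k + 2 + e := by omega
  have h := congrArg toField (multiplicitySeries_recurrence k e hn)
  have hCk : ∀ j, coeffC n C j = toField (multiplicitySeries (fundamentalWeight n (2 * j)).1
      (macdonaldKernel n)) := by
    intro j
    rw [coeffC, hC.eq_multiplicitySeries]
  have hnz : (n : ℤ) = 2 * k + 2 + e := by exact_mod_cast hn
  have d1 := tt_zpow_sub_one_ne_zero (m := 2 * ((n : ℤ) - 2 * k + 1)) (by omega)
  have d2 := tt_zpow_sub_one_ne_zero (m := 2 * ((k : ℤ) + 1)) (by omega)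
  have d3 := one_sub_qq_mul_tt_zpow_ne_zero (m := 2 * ((n : ℤ) - k) - 1) (by omega)
  have e1 : tt ^ (2 * ((n : ℤ) - 2 * k - 1)) = tt ^ (2 * e + 2) := by
    rw [← zpow_natCast]; congr 1; push_cast; omega
  have e2 : tt ^ (2 * ((n : ℤ) - k + 1)) = tt ^ (2 * e + 2 * k + 6) := by
    rw [← zpow_natCast]; congr 1; push_cast; omega
  have e3 : tt ^ (2 * ((n : ℤ) - 2 * k + 1)) = tt ^ (2 * e + 6) := by
    rw [← zpow_natCast]; congr 1; push_cast; omega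
  have e4 : tt ^ (2 * ((k : ℤ) + 1)) = tt ^ (2 * k + 2) := by
    rw [← zpow_natCast]; congr 1
  have e5 : tt ^ (2 * ((n : ℤ) - k) - 1) = tt ^ (2 * e + 2 * k + 3) := by
    rw [← zpow_natCast]; congr 1; push_cast; omega
  -- The exponent `2k - 1` is negative at `k = 0`, hence the form `(t - q t^{2k}) t` of `t² (1 - q
  -- t^{2k-1})` in the power series recurrence.
  have e6 : tt ^ (2 * (k : ℤ) - 1) * tt = tt ^ (2 * k) := by
    rw [← zpow_add_one₀ tt_ne_zero, ← zpow_natCast]; congr 1; push_cast; ring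
  rw [div_mul_eq_mul_div, eq_div_iff (mul_ne_zero (mul_ne_zero d1 d2) d3), e1, e2, e3, e4, e5]
  simp only [toField, map_mul, map_sub, map_pow, map_one] at h
  rw [hCk, hCk]
  change _ * ((tt ^ _ - 1) * (tt ^ _ - 1) * (1 - qq * tt ^ _)) = _ * ((tt ^ _ - 1) *
    (tt ^ _ - 1) * (tt - qq * tt ^ _) * tt) at h
  rw [toField, toField, h]
  rw [← e6]
  ring

theorem IsKernelExpansion.coeffC_eq {C : DominantWeight n → QT ℂ} (hC : IsKernelExpansion n C)
    (k : ℕ) (hk : 2 * k ≤ n) :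
    coeffC n C k =
      tt ^ (2 * k) *
        ((tt ^ (2 * ((n : ℤ) - 2 * k + 1)) - 1) / (tt ^ (2 * ((n : ℤ) - k + 1)) - 1)) *
        (∏ i ∈ Icc 1 k, (tt ^ (2 * ((n : ℤ) - i + 1)) - 1) / (tt ^ (2 * (i : ℤ)) - 1)) *
        (∏ i ∈ range k, (1 - qq * tt ^ (2 * (i : ℤ) - 1)) /
            (1 - qq * tt ^ (2 * ((n : ℤ) - i) - 1))) * coeffC n C 0 := by
  induction k with
  | zero =>
    have d := tt_zpow_sub_one_ne_zero (m := 2 * ((n : ℤ) + 1)) (by omega)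
    simp [div_self d]
  | succ k ih =>
    rw [hC.coeffC_succ k hk, ih (by omega), prod_Icc_succ_top (by omega), prod_range_succ]
    have d1 := tt_zpow_sub_one_ne_zero (m := 2 * ((n : ℤ) - 2 * k + 1)) (by omega)
    have d2 := tt_zpow_sub_one_ne_zero (m := 2 * ((n : ℤ) - k + 1)) (by omega)
    have d3 := tt_zpow_sub_one_ne_zero (m := 2 * ((n : ℤ) - (k + 1 : ℕ) + 1)) (by omega)
    have e1 : (n : ℤ) - 2 * (k + 1 : ℕ) + 1 = n - 2 * k - 1 := by push_cast; ring
    have e2 : 2 * (((k + 1 : ℕ)) : ℤ) = 2 * (k + 1) := by push_cast; ring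
    have e3 : tt ^ (2 * (k + 1)) = tt ^ (2 * k) * tt ^ 2 := by ring
    rw [e1, e2, e3]
    -- Three cancellations make the induction step: `D₁` and `D₂` between the ratio in (a) and the
    -- prefactor for `k`, and `D₃` between the prefactor for `k + 1` and the new factor `i = k + 1`.
    -- All other quantities are inert.
    generalize tt ^ (2 * ((n : ℤ) - 2 * k + 1)) - 1 = D₁ at *
    generalize tt ^ (2 * ((n : ℤ) - k + 1)) - 1 = D₂ at *
    generalize tt ^ (2 * ((n : ℤ) - (k + 1 : ℕ) + 1)) - 1 = D₃ at *
    simp only [div_eq_mul_inv, mul_inv]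
    have f1 : D₁ * D₁⁻¹ = 1 := mul_inv_cancel₀ d1
    have f2 : D₂ * D₂⁻¹ = 1 := mul_inv_cancel₀ d2
    have f3 : D₃ * D₃⁻¹ = 1 := mul_inv_cancel₀ d3
    generalize D₁⁻¹ = I₁ at *
    generalize D₂⁻¹ = I₂ at *
    generalize D₃⁻¹ = I₃ at *
    generalize ∏ i ∈ Icc 1 k, ((tt ^ (2 * ((n : ℤ) - i + 1)) - 1) * (tt ^ (2 * (i : ℤ)) - 1)⁻¹) = P
    generalize ∏ i ∈ range k, ((1 - qq * tt ^ (2 * (i : ℤ) - 1)) *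
      (1 - qq * tt ^ (2 * ((n : ℤ) - i) - 1))⁻¹) = S
    generalize (tt ^ (2 * ((k : ℤ) + 1)) - 1)⁻¹ = G
    generalize (1 - qq * tt ^ (2 * ((n : ℤ) - k) - 1))⁻¹ = H
    generalize 1 - qq * tt ^ (2 * (k : ℤ) - 1) = M
    generalize tt ^ (2 * ((n : ℤ) - 2 * k - 1)) - 1 = N
    generalize tt ^ (2 * k) = U
    generalize coeffC n C 0 = Z
    have g1 : N * D₂ * M * tt ^ 2 * (I₁ * G * H) * (U * (D₁ * I₂) * P * S * Z) =
        (D₁ * I₁) * (D₂ * I₂) * (N * M * tt ^ 2 * G * H * U * P * S * Z) := by ring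
    have g2 : U * tt ^ 2 * (N * I₃) * (P * (D₃ * G)) * (S * (M * H)) * Z =
        (D₃ * I₃) * (N * M * tt ^ 2 * G * H * U * P * S * Z) := by ring
    rw [g1, g2, f1, f2, f3, one_mul]

end MacdonaldC

end

theorem mainTheorem6 (n : ℕ) (hn : 1 ≤ n) :
    (∃! C : MacdonaldC.DominantWeight n → MacdonaldC.QT ℂ, MacdonaldC.IsKernelExpansion n C) ∧
    ∀ C : MacdonaldC.DominantWeight n → MacdonaldC.QT ℂ, MacdonaldC.IsKernelExpansion n C →
      (∀ k : ℕ, 2 * (k + 1) ≤ n →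
        MacdonaldC.coeffC n C (k + 1) =
          ((MacdonaldC.tt ^ (2 * ((n : ℤ) - 2 * k - 1)) - 1) *
              (MacdonaldC.tt ^ (2 * ((n : ℤ) - k + 1)) - 1) *
              (1 - MacdonaldC.qq * MacdonaldC.tt ^ (2 * (k : ℤ) - 1)) * MacdonaldC.tt ^ 2) /
            ((MacdonaldC.tt ^ (2 * ((n : ℤ) - 2 * k + 1)) - 1) *
              (MacdonaldC.tt ^ (2 * ((k : ℤ) + 1)) - 1) *
              (1 - MacdonaldC.qq * MacdonaldC.tt ^ (2 * ((n : ℤ) - k) - 1))) *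
          MacdonaldC.coeffC n C k) ∧
      (∀ k : ℕ, 2 * k ≤ n →
        MacdonaldC.coeffC n C k =
          MacdonaldC.tt ^ (2 * k) *
            ((MacdonaldC.tt ^ (2 * ((n : ℤ) - 2 * k + 1)) - 1) /
              (MacdonaldC.tt ^ (2 * ((n : ℤ) - k + 1)) - 1)) *
            (∏ i ∈ Finset.Icc 1 k,
              (MacdonaldC.tt ^ (2 * ((n : ℤ) - i + 1)) - 1) /
                (MacdonaldC.tt ^ (2 * (i : ℤ)) - 1)) *
            (∏ i ∈ Finset.range k,
              (1 - MacdonaldC.qq * MacdonaldC.tt ^ (2 * (i : ℤ) - 1)) /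
                (1 - MacdonaldC.qq * MacdonaldC.tt ^ (2 * ((n : ℤ) - i) - 1))) *
          MacdonaldC.coeffC n C 0) := by
  have hex := MacdonaldC.isKernelExpansion_multiplicitySeries
    (MacdonaldC.isSymm_coeff_macdonaldKernel (n := n))
  exact ⟨⟨_, hex, fun C hC => hC.eq_multiplicitySeries⟩,
    fun C hC => ⟨hC.coeffC_succ, hC.coeffC_eq⟩⟩
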